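/- **Theorem (online Hamming distance).** Write $[q]=\{0,\dots,q-1\}$. In the *online Hamming distance problem* there is a fixed string $F\in[q]^n$, known in advance, and a window $S$ that initially holds a string $S_0\in[q]^n$, also known in advance. Then $n$ symbols $U[0],\dots,U[n-1]\in[q]$ arrive one at a time. At the arrival of $U[t]$ it is appended to $S$ and the oldest symbol of $S$ is removed, and, before the next symbol arrives, the algorithm must output the Hamming distance $|\{i : F[i]\ne S[i]\}|$ between $F$ and the $n$ most recent symbols. In the *cell-probe model* the memory consists of cells of $w$ bits. During each arrival the algorithm adaptively reads and writes cells; its cost is the number of cell reads and writes, all other computation is free, and nothing about the stream is remembered between arrivals except through the memory. As is standard, the cell size is at least of order $\log n$ and a constant number of cells can hold the address of any cell: for a constant $\kappa$, $\log_2 n\le \kappa w$ and there are at most $2^{\kappa w}$ cells. A *randomised algorithm* is a probability distribution over deterministic algorithms (which may depend on $F$, $S_0$ and the index of the arrival, and have an arbitrary initial memory); it solves the problem if, with probability one, all its outputs are correct on every stream. For every $\kappa$ there is a constant $c>0$ such that for all positive integers $q$, $n$ and $w$ as above there is a string $F\in[q]^n$ such that for every initial window $S_0\in[q]^n$ and every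 randomised cell-probe algorithm that solves the online Hamming distance problem for $F$ and $S_0$, there is a stream $U\in[q]^n$ on which the expected number of cell probes, divided by the number $n$ of arrivals, is at least $$c\cdot\frac{\delta}{w}\log_2 n,\qquad \delta=\lceil\min\{\log_2 q,\log_2 n\}\rceil .$$ That is, the expected amortised time per arriving symbol is $\Omega\!\left(\frac{\delta}{w}\log n\right)$. -/

import Mathlib

open scoped ENNReal

/-! The cell-probe model with `s` memory cells of `w` bits each. -/

namespace CellProbe

/-- The contents of a memory cell of `w` bits. -/
abbrev Cell (w : ℕ) : Type := Fin w → Bool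

/-- The contents of a memory of `s` cells of `w` bits each. -/
abbrev Memory (s w : ℕ) : Type := Fin s → Cell w

/-- What the computing unit does during one operation: it adaptively reads and writes cells, with
arbitrary free computation in between, and finally outputs a number. -/
inductive Program (s w : ℕ) : Type
  | output (y : ℕ) : Program s w
  | read (a : Fin s) (next : Cell w → Program s w) : Program s w
  | write (a : Fin s) (v : Cell w) (next : Program s w) : Program s w

namespace Program

variable {s w : ℕ}

/-- The number that is output when the program is run on the memory `m`. -/
def result : Program s w → Memory s w → ℕ
  | output y, _ => y
  | read a next, m => (next (m a)).result m
  | write a v next, m => next.result (Function.update m a v)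

/-- The contents of the memory after the program has been run on the memory `m`. -/
def finalMemory : Program s w → Memory s w → Memory s w
  | output _, m => m
  | read a next, m => (next (m a)).finalMemory m
  | write a v next, m => next.finalMemory (Function.update m a v)

/-- The running time on the memory `m`: the number of cell probes (reads and writes). -/
def probes : Program s w → Memory s w → ℕ
  | output _, _ => 0
  | read a next, m => (next (m a)).probes m + 1
  | write a v next, m => next.probes (Function.update m a v) + 1

end Program

/-- A deterministic algorithm that processes `n` arriving symbols from the alphabet `Fin q`.
The memory is initialised in an arbitrary way, free of charge. The program run at an arrival sees
the index of the arrival and the arriving symbol; everything else it knows about the past is what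
it reads from memory. -/
structure Algorithm (q n s w : ℕ) : Type where
  /-- the initial contents of the memory -/
  init : Memory s w
  /-- the program run at a given arrival on a given symbol -/
  update : Fin n → Fin q → Program s w

namespace Algorithm

variable {q n s w : ℕ}

/-- The contents of the memory after the first `k` arrivals of the stream `U`. -/
def memory (A : Algorithm q n s w) (U : Fin n → Fin q) : ℕ → Memory s w
  | 0 => A.init
  | k + 1 =>
    if h : k < n then (A.update ⟨k, h⟩ (U ⟨k, h⟩)).finalMemory (A.memory U k) else A.memory U k

/-- The output at arrival `t` of the stream `U`. -/
def output (A : Algorithm q n s w) (U : Fin n → Fin q) (t : Fin n) : ℕ :=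
  (A.update t (U t)).result (A.memory U t)

/-- The total number of cell probes over the `n` arrivals of the stream `U`. -/
def totalProbes (A : Algorithm q n s w) (U : Fin n → Fin q) : ℕ :=
  ∑ t : Fin n, (A.update t (U t)).probes (A.memory U t)

end Algorithm

/-- A randomised algorithm: a probability distribution over deterministic algorithms. There are
only countably many of the latter, so every distribution is given by a probability mass function.
Since programs may depend on the index of the arrival, both coins that are tossed once and
coins that are tossed afresh at each arrival are covered. -/
abbrev RandomisedAlgorithm (q n s w : ℕ) : Type := PMF (Algorithm q n s w)

/-- The expected total number of cell probes over the `n` arrivals of the stream `U`. -/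
noncomputable def RandomisedAlgorithm.expectedProbes {q n s w : ℕ}
    (P : RandomisedAlgorithm q n s w) (U : Fin n → Fin q) : ℝ≥0∞ :=
  ∑' A : Algorithm q n s w, P A * (A.totalProbes U : ℝ≥0∞)

end CellProbe

namespace OnlineHamming

open CellProbe

/-- The `n` most recent symbols of the stream just after arrival `t`, when the `n` symbols `S₀`
precede the arrivals `U`. -/
def window {q n : ℕ} (S₀ U : Fin n → Fin q) (t : Fin n) : Fin n → Fin q :=
  fun i => Fin.append S₀ U ⟨t.val + 1 + i.val, by omega⟩

/-- The deterministic algorithm outputs, at each arrival of every stream, the Hamming distance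
between `F` and the `n` most recent symbols. -/
def Correct {q n s w : ℕ} (F S₀ : Fin n → Fin q) (A : Algorithm q n s w) : Prop :=
  ∀ (U : Fin n → Fin q) (t : Fin n), A.output U t = hammingDist F (window S₀ U t)

/-- The randomised algorithm solves the online Hamming distance problem: all its outputs are
correct with probability one. -/
def Solves {q n s w : ℕ} (F S₀ : Fin n → Fin q) (P : RandomisedAlgorithm q n s w) : Prop :=
  ∀ A ∈ P.support, Correct F S₀ A

/-- `δ = ⌈min {log₂ q, log₂ n}⌉`. -/
noncomputable def delta (q n : ℕ) : ℕ := ⌈min (Real.logb 2 q) (Real.logb 2 n)⌉₊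

end OnlineHamming

/-! The proof uses information transfer. Split time into dyadic pairs of consecutive periods of
length `2 ^ i`. Whatever the outputs of the second period reveal about the symbols of the first must
pass through cells probed in both. Charging such a cell to its first probe in the second period
makes the charges of different pairs disjoint, so the transfers of all pairs and scales add up to at
most the total number of probes (`sum_card_transfer_le`). Conversely, the transferred cells with
their contents determine the second period's outputs, so a family of streams told apart by these
outputs has few members with small transfer (`card_transfer_le`).

The hard instance should thus let the outputs of a period reveal about `δ` bits per symbol, at a
constant proportion of all scales. The fixed string carries a copy of one test string around every
lag `2 ^ i`, and the stream is a sequence of independent code words separated by gaps. One period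
later each word slides past the test string, and the match counts identify it
(`eq_of_hammingDist_eq`).

A match count carries only logarithmically many bits, so a good rate needs counts used without
waste. Lindström's solution of the coin-weighing problem (`exists_detecting_family`) recovers `2 ^
(2 * h - 1)` numbers of about `h` bits from `2 ^ (2 * h)` counts. `exists_gadget` runs many such
weighings in parallel, one for each residue ("colour") of the shift: block `j` delivers to each
colour at most one number, a displacement, and uniqueness is ensured by letting the displacements
come from permutations. Averaging over the code words (Yao) extends the bound to randomised
algorithms. -/

namespace CellProbe

/-! ### Cells probed by a program. -/

namespace Program

variable {s w : ℕ}

/-- The set of the cells that are probed when the program is run on the memory `m`. -/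
def probed : Program s w → Memory s w → Finset (Fin s)
  | output _, _ => ∅
  | read a next, m => insert a ((next (m a)).probed m)
  | write a v next, m => insert a (next.probed (Function.update m a v))

theorem card_probed_le (p : Program s w) (m : Memory s w) : (p.probed m).card ≤ p.probes m := by
  induction p generalizing m with
  | output y => simp [probed, probes]
  | read a next ih =>
    exact (Finset.card_insert_le _ _).trans (Nat.succ_le_succ (ih _ _))
  | write a v next ih =>
    exact (Finset.card_insert_le _ _).trans (Nat.succ_le_succ (ih _))

theorem finalMemory_eq_of_notMem (p : Program s w) (m : Memory s w) (a : Fin s)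
    (ha : a ∉ p.probed m) : p.finalMemory m a = m a := by
  induction p generalizing m with
  | output y => rfl
  | read b next ih =>
    simp only [probed, Finset.mem_insert, not_or] at ha
    exact ih _ _ ha.2
  | write b v next ih =>
    simp only [probed, Finset.mem_insert, not_or] at ha
    rw [finalMemory, ih _ ha.2, Function.update_of_ne ha.1]

/-- The runs stay in lockstep: while all values read coincide, both probe the same next cell, which
is then probed by both and so lies in `X`. -/
theorem run_congr (p : Program s w) (X : Set (Fin s)) (m m' : Memory s w)
    (h : Set.EqOn m m' X) (hX : ∀ a ∈ p.probed m, a ∈ p.probed m' → a ∈ X) :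
    p.result m = p.result m' ∧ Set.EqOn (p.finalMemory m) (p.finalMemory m') X := by
  induction p generalizing m m' with
  | output y => exact ⟨rfl, h⟩
  | read b next ih =>
    simp only [probed] at hX
    have hb := h (hX b (Finset.mem_insert_self _ _) (Finset.mem_insert_self _ _))
    simp only [result, finalMemory]
    rw [← hb] at hX ⊢
    exact ih (m b) m m' h fun a h1 h2 =>
      hX a (Finset.mem_insert_of_mem h1) (Finset.mem_insert_of_mem h2)
  | write b v next ih =>
    refine ih _ _ (fun x hx => ?_) fun a h1 h2 =>
      hX a (Finset.mem_insert_of_mem h1) (Finset.mem_insert_of_mem h2)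
    by_cases hxb : x = b
    · subst hxb; simp
    · simp [Function.update_of_ne hxb, h hx]

end Program

/-! ### Information transfer between consecutive periods. -/

namespace Algorithm

variable {q n s w : ℕ}

/-- The set of the cells that are probed at arrival `t` of the stream `U`. -/
def probedAt (A : Algorithm q n s w) (U : Fin n → Fin q) (t : ℕ) : Finset (Fin s) :=
  if h : t < n then (A.update ⟨t, h⟩ (U ⟨t, h⟩)).probed (A.memory U t) else ∅

theorem sum_card_probedAt_le (A : Algorithm q n s w) (U : Fin n → Fin q) :
    ∑ t ∈ Finset.range n, (A.probedAt U t).card ≤ A.totalProbes U := by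
  rw [Finset.sum_range]
  refine Finset.sum_le_sum fun t _ => ?_
  simp only [probedAt, t.isLt, dite_true, Fin.eta]
  exact Program.card_probed_le _ _

theorem memory_congr (A : Algorithm q n s w) {U V : Fin n → Fin q} {k : ℕ}
    (h : ∀ t : Fin n, t.val < k → U t = V t) : A.memory U k = A.memory V k := by
  induction k with
  | zero => rfl
  | succ k ih =>
    simp only [memory]
    rw [ih fun t ht => h t (by omega)]
    split_ifs with hk
    · rw [h ⟨k, hk⟩ (Nat.lt_succ_self k)]
    · rfl

theorem memory_eq_of_notMem (A : Algorithm q n s w) (U : Fin n → Fin q) (a : Fin s) (k : ℕ)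
    (d : ℕ) (h : ∀ t ∈ Finset.Ico k (k + d), a ∉ A.probedAt U t) :
    A.memory U (k + d) a = A.memory U k a := by
  induction d with
  | zero => rfl
  | succ d ih =>
    rw [← ih fun t ht => h t (by simp at ht ⊢; omega), ← add_assoc, memory]
    have := h (k + d) (by simp)
    split_ifs with hk
    · rw [probedAt, dif_pos hk] at this
      exact Program.finalMemory_eq_of_notMem _ _ _ this
    · rfl

/-- Two streams that agree on a period and start it with memories that agree on all cells probed
by both of them. -/
theorem memory_eqOn (A : Algorithm q n s w) {U V : Fin n → Fin q} {k d : ℕ} (X : Set (Fin s))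
    (hUV : ∀ t : Fin n, k ≤ t.val → t.val < k + d → U t = V t)
    (hX : ∀ t ∈ Finset.Ico k (k + d), ∀ a ∈ A.probedAt U t, a ∈ A.probedAt V t → a ∈ X)
    (h : Set.EqOn (A.memory U k) (A.memory V k) X) :
    Set.EqOn (A.memory U (k + d)) (A.memory V (k + d)) X := by
  induction d with
  | zero => exact h
  | succ d ih =>
    have ih' := ih (fun t h1 h2 => hUV t h1 (by omega)) (fun t ht => hX t (by simp at ht ⊢; omega))
    rw [← add_assoc]
    simp only [memory]
    have hp := hX (k + d) (by simp)
    split_ifs with hk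
    · simp only [probedAt, dif_pos hk] at hp
      rw [← hUV ⟨k + d, hk⟩ (by simp) (by simp)] at hp ⊢
      exact (Program.run_congr _ X _ _ ih' hp).2
    · exact ih'

theorem output_congr (A : Algorithm q n s w) {U V : Fin n → Fin q} {k d : ℕ} (X : Set (Fin s))
    (hUV : ∀ t : Fin n, k ≤ t.val → t.val < k + d → U t = V t)
    (hX : ∀ t ∈ Finset.Ico k (k + d), ∀ a ∈ A.probedAt U t, a ∈ A.probedAt V t → a ∈ X)
    (h : Set.EqOn (A.memory U k) (A.memory V k) X) (t : Fin n) (hkt : k ≤ t.val)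
    (htd : t.val < k + d) : A.output U t = A.output V t := by
  obtain ⟨e, he⟩ := Nat.exists_eq_add_of_le hkt
  have h1 := A.memory_eqOn (k := k) (d := e) X (fun t h1 h2 => hUV t h1 (by omega))
    (fun t ht => hX t (by simp at ht ⊢; omega)) h
  have hp := hX t (by simp; omega)
  simp only [probedAt, dif_pos t.isLt] at hp
  rw [← he] at h1
  rw [output, output]
  rw [← hUV t hkt htd] at hp ⊢
  exact (Program.run_congr _ X _ _ h1 hp).1

/-- The cells that are probed during the period `[2 ^ (i + 1) * v, 2 ^ (i + 1) * v + 2 ^ i)` and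
during the following period of the same length. -/
def transfer (A : Algorithm q n s w) (U : Fin n → Fin q) (i v : ℕ) : Finset (Fin s) :=
  ((Finset.Ico (2 ^ (i + 1) * v) (2 ^ (i + 1) * v + 2 ^ i)).biUnion (A.probedAt U)) ∩
    ((Finset.Ico (2 ^ (i + 1) * v + 2 ^ i) (2 ^ (i + 1) * v + 2 ^ i + 2 ^ i)).biUnion
      (A.probedAt U))

/-- The memory contents transferred between the two periods. -/
def patch (A : Algorithm q n s w) (U : Fin n → Fin q) (i v : ℕ) : Finset (Fin s × Cell w) :=
  (A.transfer U i v).image fun a => (a, A.memory U (2 ^ (i + 1) * v + 2 ^ i) a)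

theorem card_patch_le (A : Algorithm q n s w) (U : Fin n → Fin q) (i v : ℕ) :
    (A.patch U i v).card ≤ (A.transfer U i v).card := Finset.card_image_le

/-- A cell that neither stream probes in the first period still has its content from before that
period, where the streams agree. Any other cell probed by both in the second period lies in the
common transfer set, and the patch gives its content. -/
theorem output_eq_of_patch_eq (A : Algorithm q n s w) {U V : Fin n → Fin q} {i v : ℕ}
    (hUV : ∀ t : Fin n, t.val ∉ Finset.Ico (2 ^ (i + 1) * v) (2 ^ (i + 1) * v + 2 ^ i) → U t = V t)
    (hp : A.patch U i v = A.patch V i v) (t : Fin n) (h1 : 2 ^ (i + 1) * v + 2 ^ i ≤ t.val)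
    (h2 : t.val < 2 ^ (i + 1) * v + 2 ^ i + 2 ^ i) : A.output U t = A.output V t := by
  have hmem : ∀ W : Fin n → Fin q, ∀ x, x ∈ A.patch W i v ↔
      x.1 ∈ A.transfer W i v ∧ A.memory W (2 ^ (i + 1) * v + 2 ^ i) x.1 = x.2 := by
    rintro W ⟨a, c⟩
    simp only [patch, Finset.mem_image, Prod.mk.injEq]
    constructor
    · rintro ⟨b, hb, rfl, h⟩; exact ⟨hb, h⟩
    · rintro ⟨hb, h⟩; exact ⟨a, hb, rfl, h⟩
  have hUtoV : ∀ a ∈ A.transfer U i v, a ∈ A.transfer V i v ∧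
      A.memory V (2 ^ (i + 1) * v + 2 ^ i) a = A.memory U (2 ^ (i + 1) * v + 2 ^ i) a :=
    fun a ha => (hmem V (a, A.memory U (2 ^ (i + 1) * v + 2 ^ i) a)).1
      (hp ▸ (hmem U (a, A.memory U (2 ^ (i + 1) * v + 2 ^ i) a)).2 ⟨ha, rfl⟩)
  have hVtoU : ∀ a ∈ A.transfer V i v, a ∈ A.transfer U i v :=
    fun a ha => ((hmem U (a, A.memory V (2 ^ (i + 1) * v + 2 ^ i) a)).1
      (hp ▸ (hmem V (a, A.memory V (2 ^ (i + 1) * v + 2 ^ i) a)).2 ⟨ha, rfl⟩)).1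
  have hset : A.transfer U i v = A.transfer V i v :=
    Finset.Subset.antisymm (fun a ha => (hUtoV a ha).1) hVtoU
  have hcont : ∀ a ∈ A.transfer U i v, A.memory U (2 ^ (i + 1) * v + 2 ^ i) a =
      A.memory V (2 ^ (i + 1) * v + 2 ^ i) a := fun a ha => (hUtoV a ha).2.symm
  let X : Set (Fin s) := {a | a ∈ A.transfer U i v ∨
    ∀ t ∈ Finset.Ico (2 ^ (i + 1) * v) (2 ^ (i + 1) * v + 2 ^ i),
      a ∉ A.probedAt U t ∧ a ∉ A.probedAt V t}
  refine A.output_congr (d := 2 ^ i) X (fun t h _ => hUV t ?_) (fun t ht a hU hV => ?_) ?_ t h1 h2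
  · simp; omega
  · by_contra hX
    simp only [X, Set.mem_ofPred_eq, not_or, not_forall] at hX
    obtain ⟨hX, t', ht', hX'⟩ := hX
    -- Whichever stream probed `a` in the first period also probes it in the second, so `a` is in
    -- that stream's transfer; the two transfers coincide.
    by_cases hU' : a ∈ A.probedAt U t'
    · exact hX (Finset.mem_inter.2 ⟨Finset.mem_biUnion.2 ⟨t', ht', hU'⟩,
        Finset.mem_biUnion.2 ⟨t, ht, hU⟩⟩)
    · have hV' : a ∈ A.probedAt V t' := by
        by_contra hV'; exact hX' ⟨hU', hV'⟩
      rw [hset] at hX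
      exact hX (Finset.mem_inter.2 ⟨Finset.mem_biUnion.2 ⟨t', ht', hV'⟩,
        Finset.mem_biUnion.2 ⟨t, ht, hV⟩⟩)
  · rintro a (ha | ha)
    · exact hcont a ha
    · rw [A.memory_eq_of_notMem U a _ _ fun t ht => (ha t ht).1,
        A.memory_eq_of_notMem V a _ _ fun t ht => (ha t ht).2,
        A.memory_congr (U := U) (V := V) fun t ht => hUV t (by simp; omega)]

/-- Every probe is charged for at most one transferred cell. -/
theorem sum_card_transfer_le (A : Algorithm q n s w) (U : Fin n → Fin q)
    (nodes : Finset (ℕ × ℕ)) :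
    ∑ x ∈ nodes, (A.transfer U x.1 x.2).card ≤ A.totalProbes U := by
  classical
  refine le_trans ?_ (A.sum_card_probedAt_le U)
  rw [← Finset.card_sigma, ← Finset.card_sigma]
  have hex : ∀ x : (_ : ℕ × ℕ) × Fin s, x ∈ nodes.sigma (fun x => A.transfer U x.1 x.2) →
      ∃ t, 2 ^ (x.1.1 + 1) * x.1.2 + 2 ^ x.1.1 ≤ t ∧
        t < 2 ^ (x.1.1 + 1) * x.1.2 + 2 ^ x.1.1 + 2 ^ x.1.1 ∧ x.2 ∈ A.probedAt U t := by
    intro x hx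
    simp only [Finset.mem_sigma, transfer, Finset.mem_inter, Finset.mem_biUnion,
      Finset.mem_Ico] at hx
    obtain ⟨-, -, t, ht, h⟩ := hx
    exact ⟨t, ht.1, ht.2, h⟩
  -- `f` charges a transferred cell to its first probe in the second period.
  choose! f hf using fun x hx => (⟨Nat.find (hex x hx), Nat.find_spec (hex x hx),
    fun m hm => Nat.find_min (hex x hx) hm⟩ : ∃ t,
      (2 ^ (x.1.1 + 1) * x.1.2 + 2 ^ x.1.1 ≤ t ∧
        t < 2 ^ (x.1.1 + 1) * x.1.2 + 2 ^ x.1.1 + 2 ^ x.1.1 ∧ x.2 ∈ A.probedAt U t) ∧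
      ∀ m < t, ¬ (2 ^ (x.1.1 + 1) * x.1.2 + 2 ^ x.1.1 ≤ m ∧
        m < 2 ^ (x.1.1 + 1) * x.1.2 + 2 ^ x.1.1 + 2 ^ x.1.1 ∧ x.2 ∈ A.probedAt U m))
  -- If one probe were charged at two scales, the smaller pair of periods would lie inside the
  -- second period of the larger, and its own first period would contain an earlier probe of the
  -- cell.
  have key : ∀ x ∈ nodes.sigma (fun x => A.transfer U x.1 x.2),
      ∀ y ∈ nodes.sigma (fun x => A.transfer U x.1 x.2), f x = f y → x.2 = y.2 →
        ¬ x.1.1 < y.1.1 := by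
    rintro ⟨⟨i, v⟩, a⟩ hx ⟨⟨j, u⟩, b⟩ hy hfxy hab hij
    dsimp only at hab hij
    subst hab
    obtain ⟨⟨h1, h2, -⟩, -⟩ := hf _ hx
    obtain ⟨⟨h3, h4, -⟩, hmin⟩ := hf _ hy
    rw [← hfxy] at h3 h4 hmin
    simp only [Finset.mem_sigma, transfer, Finset.mem_inter, Finset.mem_biUnion,
      Finset.mem_Ico] at hx
    obtain ⟨-, ⟨t', ht', hat'⟩, -⟩ := hx
    dsimp only at h1 h2 h3 h4 hmin
    refine hmin t' (by omega) ⟨?_, by omega, hat'⟩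
    obtain ⟨d, rfl⟩ := Nat.exists_eq_add_of_lt hij
    -- The larger second period starts at a multiple of `2 ^ (i + 1)`, hence not strictly inside the
    -- smaller pair.
    have e1 : 2 ^ (i + d + 1 + 1) * u + 2 ^ (i + d + 1) = 2 ^ (i + 1) * (2 ^ d * (2 * u + 1)) := by
      ring
    rw [e1] at h3 ⊢
    generalize 2 ^ d * (2 * u + 1) = z at h3 ⊢
    have h5 : z < v + 1 := by
      have : 2 ^ (i + 1) * z < 2 ^ (i + 1) * (v + 1) := by
        have : 2 ^ (i + 1) = 2 ^ i + 2 ^ i := by ring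
        rw [mul_add, mul_one]; omega
      exact lt_of_mul_lt_mul_left this (Nat.zero_le _)
    exact (Nat.mul_le_mul_left _ (Nat.lt_succ_iff.1 h5)).trans ht'.1
  refine Finset.card_le_card_of_injOn (fun x => ⟨f x, x.2⟩) ?_ ?_
  · intro x hx
    obtain ⟨⟨-, -, h⟩, -⟩ := hf x hx
    simp only [Finset.coe_sigma, Set.mem_sigma_iff, Finset.mem_coe, Finset.mem_range]
    refine ⟨?_, h⟩
    by_contra hn
    simp [probedAt, hn] at h
  · intro x hx y hy hxy
    simp only [Sigma.mk.injEq, heq_eq_eq] at hxy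
    have hi : x.1.1 = y.1.1 := le_antisymm (not_lt.1 (key y hy x hx hxy.1.symm hxy.2.symm))
      (not_lt.1 (key x hx y hy hxy.1 hxy.2))
    obtain ⟨⟨h1, h2, -⟩, -⟩ := hf _ hx
    obtain ⟨⟨h3, h4, -⟩, -⟩ := hf _ hy
    obtain ⟨⟨i, v⟩, a⟩ := x
    obtain ⟨⟨j, u⟩, b⟩ := y
    obtain ⟨hxy, hab⟩ := hxy
    dsimp only at hi hab h1 h2 h3 h4
    subst hi hab
    rw [← hxy] at h3 h4
    have e : 2 ^ (i + 1) = 2 ^ i + 2 ^ i := by ring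
    have hv : ∀ v u : ℕ, 2 ^ (i + 1) * v < 2 ^ (i + 1) * u + 2 ^ (i + 1) → v ≤ u := by
      intro v u h
      rw [← Nat.mul_succ] at h
      exact Nat.lt_succ_iff.1 (lt_of_mul_lt_mul_left h (Nat.zero_le _))
    have : v = u := le_antisymm (hv _ _ (by omega)) (hv _ _ (by omega))
    subst this
    rfl

/-- Few streams of a family that is distinguished by the outputs of the second period have a small
transfer. -/
theorem card_transfer_le (A : Algorithm q n s w) {Φ Y : Type*} [Fintype Φ] [Fintype Y]
    (U : Φ → Fin n → Fin q) (key : Φ → Y) (i v N : ℕ)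
    (hkey : ∀ φ ψ, key φ = key ψ → ∀ t : Fin n,
      t.val ∉ Finset.Ico (2 ^ (i + 1) * v) (2 ^ (i + 1) * v + 2 ^ i) → U φ t = U ψ t)
    (hinj : ∀ φ ψ, key φ = key ψ → (∀ t : Fin n, 2 ^ (i + 1) * v + 2 ^ i ≤ t.val →
      t.val < 2 ^ (i + 1) * v + 2 ^ i + 2 ^ i → A.output (U φ) t = A.output (U ψ) t) → φ = ψ) :
    (Finset.univ.filter fun φ => (A.transfer (U φ) i v).card ≤ N).card ≤
      Fintype.card Y * (s * 2 ^ w + 1) ^ N := by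
  classical
  have hcard : (s * 2 ^ w + 1) ^ N = Fintype.card (Fin N → Option (Fin s × Cell w)) := by
    simp [Cell]
  rw [hcard, ← Fintype.card_prod]
  -- A patch is listed in `N` slots padded with `none`; this padding symbol is the `+ 1` in the
  -- bound.
  have hcode : ∀ P : Finset (Fin s × Cell w), P.card ≤ N →
      ∃ c : Fin N → Option (Fin s × Cell w), ∀ x, x ∈ P ↔ ∃ j, c j = some x := by
    intro P hP
    refine ⟨fun j => if h : j.val < P.card then some (P.equivFin.symm ⟨j, h⟩) else none,
      fun x => ⟨fun hx => ⟨⟨P.equivFin ⟨x, hx⟩, lt_of_lt_of_le (Fin.isLt _) hP⟩, by simp⟩, ?_⟩⟩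
    rintro ⟨j, hj⟩
    dsimp only at hj
    split_ifs at hj with h
    · rw [← Option.some.inj hj]; exact Subtype.coe_prop _
  choose! code hc using hcode
  refine Finset.card_le_card_of_injOn (t := Finset.univ)
    (fun φ => (key φ, code (A.patch (U φ) i v))) (fun _ _ => by simp) ?_
  intro φ hφ ψ hψ h
  simp only [Prod.mk.injEq] at h
  simp only [Finset.coe_filter, Finset.mem_univ, true_and, Set.mem_ofPred_eq] at hφ hψ
  have hpatch : A.patch (U φ) i v = A.patch (U ψ) i v := by
    ext x
    rw [hc _ ((A.card_patch_le _ _ _).trans hφ), hc _ ((A.card_patch_le _ _ _).trans hψ), h.2]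
  exact hinj φ ψ h.1 fun t h1 h2 => A.output_eq_of_patch_eq (hkey φ ψ h.1) hpatch t h1 h2

end Algorithm

end CellProbe

/-! ### Lindström's detecting family. -/

namespace Finset

/-- Toggling an element of `S \ T` flips the sign of a term and leaves `A ∩ T` unchanged. -/
theorem sum_powerset_neg_one_pow_card_mul_indicator_eq_zero {ι : Type*} [DecidableEq ι]
    {S T : Finset ι} (hST : ¬ S ⊆ T) (f : Finset ι → ℤ) :
    ∑ A ∈ S.powerset, (-1) ^ A.card * f (A ∩ T) = 0 := by
  obtain ⟨a, haS, haT⟩ := Finset.not_subset.1 hST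
  rw [← Finset.insert_erase haS, Finset.sum_powerset_insert (Finset.notMem_erase a S),
    ← Finset.sum_add_distrib]
  refine Finset.sum_eq_zero fun A hA => ?_
  have ha : a ∉ A := fun h => Finset.notMem_erase a S (Finset.mem_powerset.1 hA h)
  rw [Finset.card_insert_of_notMem ha, Finset.insert_inter_of_notMem haT]
  ring

theorem two_mul_card_powerset_filter_even {ι : Type*} [DecidableEq ι] {S : Finset ι}
    (hS : S.Nonempty) : 2 * (S.powerset.filter fun A => Even A.card).card = 2 ^ S.card := by
  have h0 := Finset.sum_powerset_neg_one_pow_card_of_nonempty hS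
  have h1 : ∀ A : Finset ι, ((-1 : ℤ)) ^ A.card = 2 * (if Even A.card then 1 else 0) - 1 := by
    intro A
    split_ifs with h
    · simp [h.neg_one_pow]
    · simp [(Nat.not_even_iff_odd.1 h).neg_one_pow]
  simp only [h1, Finset.sum_sub_distrib, ← Finset.mul_sum, Finset.sum_boole, Finset.sum_const,
    Finset.card_powerset] at h0
  simp only [nsmul_eq_mul, mul_one, Nat.cast_pow, Nat.cast_ofNat] at h0
  exact_mod_cast (sub_eq_zero.1 h0)

theorem two_pow_le_two_mul_card_filter_le_card (h : ℕ) :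
    2 ^ (2 * h) ≤ 2 * (Finset.univ.filter fun S : Finset (Fin (2 * h)) => h ≤ S.card).card := by
  have h1 : (Finset.univ.filter fun S : Finset (Fin (2 * h)) => ¬ h ≤ S.card).card ≤
      (Finset.univ.filter fun S : Finset (Fin (2 * h)) => h ≤ S.card).card := by
    refine Finset.card_le_card_of_injOn compl ?_ compl_injective.injOn
    intro S hS
    simp only [Finset.coe_filter, Finset.mem_univ, true_and, Set.mem_ofPred_eq, Finset.card_compl,
      Fintype.card_fin] at hS ⊢
    omega
  have h2 := Finset.card_filter_add_card_filter_not (s := (Finset.univ : Finset (Finset (Fin (2 * h)))))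
    (fun S => h ≤ S.card)
  simp at h2 h1
  omega

end Finset

/-- Lindström's detecting family: `2 ^ (2 * h)` counts determine `2 ^ (2 * h - 1)` numbers
below `2 ^ (h - 1)`. -/
theorem exists_detecting_family (h : ℕ) (hh : 0 < h) :
    ∃ (good : Finset (Fin (2 ^ (2 * h)))) (M : Fin (2 ^ (2 * h)) → ℕ → Fin (2 ^ (2 * h)) → Prop),
      2 ^ (2 * h) ≤ 2 * good.card ∧ (∀ j τ, ¬ M j 0 τ) ∧
      ∀ α β : Fin (2 ^ (2 * h)) → ℕ, (∀ j, α j ≤ 2 ^ (h - 1)) → (∀ j, β j ≤ 2 ^ (h - 1)) →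
        (∀ j ∉ good, α j = β j) →
        (∀ τ, Nat.card {j // M j (α j) τ} = Nat.card {j // M j (β j) τ}) → α = β := by
  classical
  let e : Fin (2 ^ (2 * h)) ≃ Finset (Fin (2 * h)) :=
    (Fintype.equivFinOfCardEq (by simp)).symm
  -- The number `a` is represented by `a` even subsets of `S`; a set of size at least `h` has at
  -- least `2 ^ (h - 1)` of them.
  have hE : ∀ (S : Finset (Fin (2 * h))) (a : ℕ), ∃ E : Finset (Finset (Fin (2 * h))),
      (a = 0 → E = ∅) ∧ (h ≤ S.card → a ≤ 2 ^ (h - 1) →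
        E ⊆ S.powerset.filter (fun A => Even A.card) ∧ E.card = a) := by
    intro S a
    by_cases hS : h ≤ S.card ∧ a ≤ 2 ^ (h - 1)
    · have h2 := Finset.two_mul_card_powerset_filter_even
        (Finset.card_pos.1 (hh.trans_le hS.1))
      have h3 : 2 ^ h ≤ 2 ^ S.card := Nat.pow_le_pow_right (by norm_num) hS.1
      have h4 : 2 * 2 ^ (h - 1) = 2 ^ h := by rw [← pow_succ']; congr 1; omega
      obtain ⟨E, hE1, hE2⟩ := Finset.exists_subset_card_eq
        (s := S.powerset.filter (fun A => Even A.card)) (n := a) (by omega)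
      exact ⟨E, fun ha => Finset.card_eq_zero.1 (hE2.trans ha), fun _ _ => ⟨hE1, hE2⟩⟩
    · exact ⟨∅, fun _ => rfl, fun h1 h2 => absurd ⟨h1, h2⟩ hS⟩
  choose E hE0 hE1 using hE
  refine ⟨Finset.univ.filter fun j => h ≤ (e j).card, fun j a τ => e τ ∩ e j ∈ E (e j) a,
    ?_, fun j τ => by simp [hE0 _ 0 rfl], ?_⟩
  · refine (Finset.two_pow_le_two_mul_card_filter_le_card h).trans
      (Nat.mul_le_mul_left _ (Finset.card_le_card_of_injOn e.symm ?_ e.symm.injective.injOn))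
    intro S hS
    simpa using hS
  intro α β hα hβ hgood hcount
  by_contra hne
  obtain ⟨j₀, hj₀⟩ := Function.ne_iff.1 hne
  -- Decoding starts from the largest sets: at any `k ≠ j` with `e j ⊆ e k` the two vectors already
  -- agree.
  obtain ⟨j, hj, hmax⟩ := Finset.exists_max_image (Finset.univ.filter fun j => α j ≠ β j)
    (fun j => (e j).card) ⟨j₀, by simpa using hj₀⟩
  simp only [Finset.mem_filter, Finset.mem_univ, true_and] at hj hmax
  have hjg : h ≤ (e j).card := by
    by_contra hc
    exact hj (hgood j (by simpa using hc))
  have hcount' : ∀ A : Finset (Fin (2 * h)),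
      ∑ k, ((if A ∩ e k ∈ E (e k) (α k) then (1 : ℤ) else 0) -
        (if A ∩ e k ∈ E (e k) (β k) then (1 : ℤ) else 0)) = 0 := by
    intro A
    have := hcount (e.symm A)
    simp only [Equiv.apply_symm_apply, Nat.card_eq_fintype_card, Fintype.card_subtype] at this
    rw [Finset.sum_sub_distrib, Finset.sum_boole, Finset.sum_boole, this, sub_self]
  -- The alternating sum over the subsets of `e j` removes every `k` with `e j ⊄ e k`. For `k = j`
  -- only even sets are counted, all with sign `+1`, so `α j - β j` remains.
  have hsum : ∑ k, ∑ A ∈ (e j).powerset, (-1 : ℤ) ^ A.card *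
      ((if A ∩ e k ∈ E (e k) (α k) then (1 : ℤ) else 0) -
        (if A ∩ e k ∈ E (e k) (β k) then (1 : ℤ) else 0)) = 0 := by
    rw [Finset.sum_comm]
    refine Finset.sum_eq_zero fun A _ => ?_
    rw [← Finset.mul_sum, hcount' A, mul_zero]
  rw [Finset.sum_eq_single j] at hsum
  · have hval : ∀ a ≤ 2 ^ (h - 1), ∑ A ∈ (e j).powerset, (-1 : ℤ) ^ A.card *
        (if A ∩ e j ∈ E (e j) a then (1 : ℤ) else 0) = a := by
      intro a ha
      obtain ⟨h1, h2⟩ := hE1 (e j) a hjg ha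
      have h3 : ∀ A ∈ (e j).powerset, (-1 : ℤ) ^ A.card *
          (if A ∩ e j ∈ E (e j) a then (1 : ℤ) else 0) = if A ∈ E (e j) a then 1 else 0 := by
        intro A hA
        rw [Finset.inter_eq_left.2 (Finset.mem_powerset.1 hA)]
        split_ifs with hAE
        · rw [(Finset.mem_filter.1 (h1 hAE)).2.neg_one_pow, mul_one]
        · simp
      rw [Finset.sum_congr rfl h3, Finset.sum_boole, Finset.filter_mem_eq_inter,
        Finset.inter_eq_right.2 (h1.trans (Finset.filter_subset _ _)), h2]
    simp only [mul_sub, Finset.sum_sub_distrib, hval _ (hα j), hval _ (hβ j)] at hsum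
    exact hj (by exact_mod_cast sub_eq_zero.1 hsum)
  · intro k _ hkj
    by_cases hsub : e j ⊆ e k
    · have hk : α k = β k := by
        by_contra hk
        exact hkj (e.injective (Finset.eq_of_subset_of_card_le hsub (hmax k hk))).symm
      simp [hk]
    · exact Finset.sum_powerset_neg_one_pow_card_mul_indicator_eq_zero hsub
        (fun B => (if B ∈ E (e k) (α k) then (1 : ℤ) else 0) -
          (if B ∈ E (e k) (β k) then (1 : ℤ) else 0))
  · simp

/-! ### Gadgets: codes identified by match counts. -/

namespace OnlineHamming

/-- A code of words of length `2 ^ b` together with a test string, indexed by lags of absolute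
value less than `2 ^ b`, such that the numbers of matches between a code word and the shifts of
the test string determine the code word. -/
structure Gadget (q b : ℕ) where
  /-- the index set of the code -/
  Index : Type
  [fintypeIndex : Fintype Index]
  /-- the code words -/
  word : Index → ℕ → ℕ
  /-- the test string -/
  test : ℤ → ℕ
  word_lt : ∀ x p, word x p < q
  test_lt : ∀ d, test d < q
  test_eq_zero : ∀ d, (2 ^ b : ℤ) ≤ |d| → test d = 0
  -- Against the zeros beyond the test string a word matches in its own zeros; as their number is
  -- constant on the code, words at a distance do not disturb the counts.
  card_zero : ∀ x y, ((Finset.range (2 ^ b)).filter fun p => word x p = 0).card =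
    ((Finset.range (2 ^ b)).filter fun p => word y p = 0).card
  eq_of_card_eq : ∀ x y, (∀ s : ℕ, s < 2 ^ b →
    ((Finset.range (2 ^ b)).filter fun p => word x p = test ((s : ℤ) - p)).card =
    ((Finset.range (2 ^ b)).filter fun p => word y p = test ((s : ℤ) - p)).card) → x = y

attribute [instance] Gadget.fintypeIndex

/-- The gadget with the code words `01` and `10`. -/
def binaryGadget (q : ℕ) (hq : 2 ≤ q) : Gadget q 1 where
  Index := Bool
  word x p := if p = x.toNat then 1 else 0
  test d := if d = 0 then 1 else 0
  word_lt x p := by split_ifs <;> omega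
  test_lt d := by split_ifs <;> omega
  test_eq_zero d hd := by
    rw [if_neg]
    rintro rfl
    norm_num at hd
  card_zero := by decide
  eq_of_card_eq := by
    intro x y h
    -- Shift 0 compares with the symbols `1, 0`: one code word matches twice, the other never.
    have h0 := h 0 (by norm_num)
    clear h
    revert h0
    cases x <;> cases y <;> decide

/-! ### The high-rate code built from displacements. -/

namespace CodeConstruction

variable (h : ℕ)

/-- A permutation of `Fin (2 ^ (h - 2))` for every good block and every one of its parts. -/
abbrev PermFamily (good : Finset (Fin (2 ^ (2 * h)))) : Type :=
  {j // j ∈ good} × Fin (2 * 2 ^ (2 * h)) → Equiv.Perm (Fin (2 ^ (h - 2)))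

variable {h} {good : Finset (Fin (2 ^ (2 * h)))}

/-- The displacement of residue `r` in block `j`. It vanishes if the position is unused. -/
def shift (x : PermFamily h good) (j : Fin (2 ^ (2 * h))) (r : ℕ) : ℕ :=
  -- Each part of length `2 ^ (h - 2)` is permuted onto the next part, so displacements of used
  -- positions are positive and 0 is free to mark unused ones.
  if hj : j ∈ good ∧ r < 2 * 2 ^ (2 * h) * 2 ^ (h - 2) then
    (x (⟨j, hj.1⟩, ⟨r / 2 ^ (h - 2), Nat.div_lt_of_lt_mul (by rw [mul_comm]; exact hj.2)⟩)
      ⟨r % 2 ^ (h - 2), Nat.mod_lt _ (by positivity)⟩ : ℕ) + 2 ^ (h - 2) - r % 2 ^ (h - 2)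
  else 0

theorem shift_lt (x : PermFamily h good) (j : Fin (2 ^ (2 * h))) (r : ℕ) :
    shift x j r < 2 * 2 ^ (h - 2) := by
  unfold shift
  split_ifs with hj
  · have := (x (⟨j, hj.1⟩, ⟨r / 2 ^ (h - 2), Nat.div_lt_of_lt_mul (by rw [mul_comm]; exact hj.2)⟩)
      ⟨r % 2 ^ (h - 2), Nat.mod_lt _ (by positivity)⟩).isLt
    omega
  · positivity

theorem shift_ne_zero_iff (x : PermFamily h good) (j : Fin (2 ^ (2 * h))) (r : ℕ) :
    shift x j r ≠ 0 ↔ j ∈ good ∧ r < 2 * 2 ^ (2 * h) * 2 ^ (h - 2) := by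
  unfold shift
  split_ifs with hj
  · have := Nat.mod_lt r (show 0 < 2 ^ (h - 2) by positivity)
    simp only [hj, and_self, iff_true]
    omega
  · simp [hj]

theorem add_shift (x : PermFamily h good) {j : Fin (2 ^ (2 * h))} {r : ℕ}
    (hj : j ∈ good ∧ r < 2 * 2 ^ (2 * h) * 2 ^ (h - 2)) :
    r + shift x j r = 2 ^ (h - 2) * (r / 2 ^ (h - 2) + 1) +
      x (⟨j, hj.1⟩, ⟨r / 2 ^ (h - 2), Nat.div_lt_of_lt_mul (by rw [mul_comm]; exact hj.2)⟩)
        ⟨r % 2 ^ (h - 2), Nat.mod_lt _ (by positivity)⟩ := by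
  rw [shift, dif_pos hj]
  have h1 := Nat.mod_lt r (show 0 < 2 ^ (h - 2) by positivity)
  have h2 := Nat.div_add_mod r (2 ^ (h - 2))
  rw [mul_add, mul_one]
  omega

/-- Distinct parts have distinct target parts, and within a part the map is a permutation. Hence a
colour receives at most one displacement from each block. -/
theorem add_shift_injOn (x : PermFamily h good) (j : Fin (2 ^ (2 * h))) {r r' : ℕ}
    (hr : shift x j r ≠ 0) (hr' : shift x j r' ≠ 0)
    (he : r + shift x j r = r' + shift x j r') : r = r' := by
  rw [shift_ne_zero_iff] at hr hr'
  rw [add_shift x hr, add_shift x hr'] at he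
  have hL : 0 < 2 ^ (h - 2) := by positivity
  have h1 := congrArg (· / 2 ^ (h - 2)) he
  simp only [Nat.mul_add_div hL, Nat.div_eq_of_lt (Fin.isLt _), add_zero,
    Nat.add_right_cancel_iff] at h1
  have h2 := congrArg (· % 2 ^ (h - 2)) he
  simp only [Nat.mul_add_mod, Nat.mod_eq_of_lt (Fin.isLt _)] at h2
  simp only [h1] at h2
  have h3 := (x _).injective (Fin.ext h2)
  rw [← Nat.div_add_mod r (2 ^ (h - 2)), ← Nat.div_add_mod r' (2 ^ (h - 2)), h1,
    Fin.mk.inj h3]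

theorem shift_injective : Function.Injective (shift : PermFamily h good → _) := by
  intro x y hxy
  ext ⟨⟨j, hj⟩, k⟩ i
  have hL : 0 < 2 ^ (h - 2) := by positivity
  have hk : 2 ^ (h - 2) * k.val + i.val < 2 * 2 ^ (2 * h) * 2 ^ (h - 2) := by
    have h1 := i.isLt
    have h2 : 2 ^ (h - 2) * (k.val + 1) ≤ 2 ^ (h - 2) * (2 * 2 ^ (2 * h)) :=
      Nat.mul_le_mul_left _ k.isLt
    rw [mul_comm (2 * 2 ^ (2 * h))]
    rw [mul_add, mul_one] at h2
    omega
  have h1 := congrArg (2 ^ (h - 2) * k.val + i.val + ·)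
    (congrFun (congrFun hxy j) (2 ^ (h - 2) * k.val + i.val))
  simp only [add_shift x ⟨hj, hk⟩, add_shift y ⟨hj, hk⟩, Nat.mul_add_div hL,
    Nat.div_eq_of_lt i.isLt, Nat.mul_add_mod, Nat.mod_eq_of_lt i.isLt, add_zero,
    Nat.add_left_cancel_iff] at h1
  exact h1

/-- The code word: position `r` of block `j` encodes the pair of `j` and the displacement. -/
def word (x : PermFamily h good) (p : ℕ) : ℕ :=
  if hp : p / 2 ^ (3 * h) < 2 ^ (2 * h) then
    if shift x ⟨p / 2 ^ (3 * h), hp⟩ (p % 2 ^ (3 * h)) = 0 then 0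
    else 1 + 2 * 2 ^ (h - 2) * (p / 2 ^ (3 * h)) +
      shift x ⟨p / 2 ^ (3 * h), hp⟩ (p % 2 ^ (3 * h))
  else 0

open scoped Classical in
/-- The test string. -/
noncomputable def test (M : Fin (2 ^ (2 * h)) → ℕ → Fin (2 ^ (2 * h)) → Prop) (d : ℤ) : ℕ :=
  -- The residue of the lag spells out a block `j` and a displacement in base `2 * 2 ^ (h - 2)`; the
  -- quotient is `τ - j`, which yields the weighing `τ`.
  if ∃ j τ : Fin (2 ^ (2 * h)), (j : ℤ) = d % 2 ^ (3 * h) / (2 * 2 ^ (h - 2)) ∧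
      (τ : ℤ) = d / 2 ^ (3 * h) + j ∧ M j (d % 2 ^ (3 * h) % (2 * 2 ^ (h - 2))).toNat τ
  then (d % 2 ^ (3 * h)).toNat + 1 else 0

/-- The number that colour `c` receives from block `j`. -/
noncomputable def weight (x : PermFamily h good) (c : ℕ) (j : Fin (2 ^ (2 * h))) : ℕ :=
  open scoped Classical in
  if hr : ∃ r, shift x j r ≠ 0 ∧ r + 2 * 2 ^ (h - 2) * j + shift x j r = c then
    shift x j hr.choose else 0

theorem weight_eq (x : PermFamily h good) {c : ℕ} {j : Fin (2 ^ (2 * h))} {r : ℕ}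
    (hr : shift x j r ≠ 0) (hc : r + 2 * 2 ^ (h - 2) * j + shift x j r = c) :
    weight x c j = shift x j r := by
  have hex : ∃ r, shift x j r ≠ 0 ∧ r + 2 * 2 ^ (h - 2) * j + shift x j r = c := ⟨r, hr, hc⟩
  rw [weight, dif_pos hex]
  rw [add_shift_injOn x j hex.choose_spec.1 hr (by have := hex.choose_spec.2; omega)]

theorem exists_of_weight_ne_zero (x : PermFamily h good) {c : ℕ} {j : Fin (2 ^ (2 * h))}
    (hw : weight x c j ≠ 0) :
    ∃ r, shift x j r ≠ 0 ∧ r + 2 * 2 ^ (h - 2) * j + shift x j r = c ∧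
      weight x c j = shift x j r := by
  by_cases hex : ∃ r, shift x j r ≠ 0 ∧ r + 2 * 2 ^ (h - 2) * j + shift x j r = c
  · obtain ⟨r, h1, h2⟩ := hex
    exact ⟨r, h1, h2, weight_eq x h1 h2⟩
  · exact absurd (by rw [weight, dif_neg hex]) hw

/-- Used positions fill the first half of a block. With `residue_lt`, this keeps the colour of every
used position below the block length. -/
theorem two_mul_two_pow (hh : 2 ≤ h) :
    2 * (2 * 2 ^ (2 * h) * 2 ^ (h - 2)) = 2 ^ (3 * h) := by
  rw [← pow_succ', ← pow_add, ← pow_succ']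
  congr 1
  omega

theorem residue_lt (x : PermFamily h good) (j : Fin (2 ^ (2 * h))) (r : ℕ) :
    2 * 2 ^ (h - 2) * j + shift x j r < 2 * 2 ^ (2 * h) * 2 ^ (h - 2) := by
  have h1 : 2 * 2 ^ (h - 2) * (j.val + 1) ≤ 2 * 2 ^ (h - 2) * 2 ^ (2 * h) :=
    Nat.mul_le_mul_left _ j.isLt
  have h2 := shift_lt x j r
  rw [mul_add, mul_one] at h1
  calc _ < 2 * 2 ^ (h - 2) * 2 ^ (2 * h) := by omega
    _ = _ := by ring

/-- A nonzero test symbol is one more than the residue of its lag, so equality forces `c - r` to be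
congruent to the pair encoded at `r`. Both are small enough to be equal, the quotient of the lag is
then `τ - j`, and the test reduces to `M`. -/
theorem eq_test_iff (hh : 2 ≤ h) (M : Fin (2 ^ (2 * h)) → ℕ → Fin (2 ^ (2 * h)) → Prop)
    (x : PermFamily h good) {c : ℕ} (hc : c < 2 ^ (3 * h)) (j τ : Fin (2 ^ (2 * h))) {r : ℕ}
    (hr : shift x j r ≠ 0) :
    1 + 2 * 2 ^ (h - 2) * j + shift x j r =
        test M (((2 ^ (3 * h) * τ + c : ℕ) : ℤ) - ((2 ^ (3 * h) * j + r : ℕ) : ℤ)) ↔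
      r + 2 * 2 ^ (h - 2) * j + shift x j r = c ∧ M j (shift x j r) τ := by
  have hK := two_mul_two_pow hh
  have ha := residue_lt x j r
  have hr' := ((shift_ne_zero_iff x j r).1 hr).2
  have hs := shift_lt x j r
  have hd : (((2 ^ (3 * h) * τ + c : ℕ) : ℤ) - ((2 ^ (3 * h) * j + r : ℕ) : ℤ)) =
      ((c : ℤ) - r) + 2 ^ (3 * h) * ((τ : ℤ) - j) := by push_cast; ring
  rw [hd]
  have hdiv : ((2 * 2 ^ (h - 2) * j + shift x j r : ℕ) : ℤ) / (2 * 2 ^ (h - 2)) = j := by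
    have : (2 * 2 ^ (h - 2) * j + shift x j r) / (2 * 2 ^ (h - 2)) = (j : ℕ) := by
      rw [Nat.mul_add_div (by positivity), Nat.div_eq_of_lt hs, add_zero]
    exact_mod_cast this
  have hmod : ((2 * 2 ^ (h - 2) * j + shift x j r : ℕ) : ℤ) % (2 * 2 ^ (h - 2)) = shift x j r := by
    have : (2 * 2 ^ (h - 2) * j + shift x j r) % (2 * 2 ^ (h - 2)) = shift x j r := by
      rw [Nat.mul_add_mod, Nat.mod_eq_of_lt hs]
    exact_mod_cast this
  have hKpos : (0 : ℤ) < 2 ^ (3 * h) := by positivity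
  constructor
  · intro he
    unfold test at he
    split_ifs at he with hex
    · obtain ⟨j', τ', h1, h2, h3⟩ := hex
      have hnn := Int.emod_nonneg ((c : ℤ) - r + 2 ^ (3 * h) * ((τ : ℤ) - j)) hKpos.ne'
      have hres : ((c : ℤ) - r + 2 ^ (3 * h) * ((τ : ℤ) - j)) % 2 ^ (3 * h) =
          ((2 * 2 ^ (h - 2) * j + shift x j r : ℕ) : ℤ) := by omega
      rw [hres, hdiv] at h1
      have hjj : j' = j := Fin.ext (by exact_mod_cast h1)
      subst hjj
      rw [hres, hmod, Int.toNat_natCast] at h3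
      rw [Int.add_mul_emod_self_left] at hres
      have hcr : (c : ℤ) - r = ((2 * 2 ^ (h - 2) * j' + shift x j' r : ℕ) : ℤ) := by
        have h4 : ((c : ℤ) - r - ((2 * 2 ^ (h - 2) * j' + shift x j' r : ℕ) : ℤ)) % 2 ^ (3 * h)
            = 0 := by
          rw [← hres]; simp
        have h5 : |(c : ℤ) - r - ((2 * 2 ^ (h - 2) * j' + shift x j' r : ℕ) : ℤ)| <
            2 ^ (3 * h) := by
          have : ((2 ^ (3 * h) : ℕ) : ℤ) = 2 ^ (3 * h) := by push_cast; rfl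
          rw [← this, abs_lt]
          generalize 2 * 2 ^ (h - 2) * (j' : ℕ) + shift x j' r = z at ha ⊢
          generalize 2 * 2 ^ (2 * h) * 2 ^ (h - 2) = R at *
          constructor <;> omega
        have := Int.eq_zero_of_abs_lt_dvd (Int.dvd_of_emod_eq_zero h4) h5
        omega
      refine ⟨by omega, ?_⟩
      rw [Int.add_mul_ediv_left _ _ hKpos.ne', hcr, Int.ediv_eq_zero_of_lt (by positivity) (by
        have : ((2 ^ (3 * h) : ℕ) : ℤ) = 2 ^ (3 * h) := by push_cast; rfl
        rw [← this]
        exact_mod_cast (by omega : 2 * 2 ^ (h - 2) * (j' : ℕ) + shift x j' r < 2 ^ (3 * h)))] at h2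
      have : τ' = τ := Fin.ext (by omega)
      rwa [this] at h3
    · omega
  · rintro ⟨he, hM⟩
    have hcr : (c : ℤ) - r = ((2 * 2 ^ (h - 2) * j + shift x j r : ℕ) : ℤ) := by omega
    have hlt : ((2 * 2 ^ (h - 2) * j + shift x j r : ℕ) : ℤ) < 2 ^ (3 * h) := by
      have : ((2 ^ (3 * h) : ℕ) : ℤ) = 2 ^ (3 * h) := by push_cast; rfl
      rw [← this]
      exact_mod_cast (by omega : 2 * 2 ^ (h - 2) * (j : ℕ) + shift x j r < 2 ^ (3 * h))
    unfold test
    rw [Int.add_mul_emod_self_left, Int.add_mul_ediv_left _ _ hKpos.ne', hcr,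
      Int.ediv_eq_zero_of_lt (by positivity) hlt, Int.emod_eq_of_lt (by positivity) hlt,
      hdiv, hmod, if_pos]
    · simp only [Int.toNat_natCast]; omega
    · exact ⟨j, τ, rfl, by ring, by simpa using hM⟩

theorem word_mul_add (x : PermFamily h good) (j : Fin (2 ^ (2 * h))) {r : ℕ}
    (hr : r < 2 ^ (3 * h)) : word x (2 ^ (3 * h) * j + r) =
      if shift x j r = 0 then 0 else 1 + 2 * 2 ^ (h - 2) * j + shift x j r := by
  have h1 : (2 ^ (3 * h) * j + r) / 2 ^ (3 * h) = j := by
    rw [Nat.mul_add_div (by positivity), Nat.div_eq_of_lt hr, add_zero]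
  have h2 : (2 ^ (3 * h) * j + r) % 2 ^ (3 * h) = r := by
    rw [Nat.mul_add_mod, Nat.mod_eq_of_lt hr]
  simp only [word, h1, h2, j.isLt, dite_true, Fin.eta]

theorem exists_eq_mul_add {p : ℕ} (hp : p < 2 ^ (5 * h)) :
    ∃ (j : Fin (2 ^ (2 * h))) (r : ℕ), r < 2 ^ (3 * h) ∧ p = 2 ^ (3 * h) * j + r := by
  refine ⟨⟨p / 2 ^ (3 * h), Nat.div_lt_of_lt_mul ?_⟩, p % 2 ^ (3 * h),
    Nat.mod_lt _ (by positivity), (Nat.div_add_mod _ _).symm⟩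
  rw [← pow_add]
  convert hp using 2
  ring

theorem mul_add_lt (j : Fin (2 ^ (2 * h))) {r : ℕ} (hr : r < 2 ^ (3 * h)) :
    2 ^ (3 * h) * j + r < 2 ^ (5 * h) := by
  have h1 : 2 ^ (3 * h) * (j.val + 1) ≤ 2 ^ (3 * h) * 2 ^ (2 * h) := Nat.mul_le_mul_left _ j.isLt
  have h2 : 2 ^ (3 * h) * 2 ^ (2 * h) = 2 ^ (5 * h) := by rw [← pow_add]; congr 1; ring
  rw [mul_add, mul_one] at h1
  omega

/-- Matches in the symbol 0 are thereby the same for all code words and cancel in comparisons. -/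
theorem word_eq_zero_iff (x y : PermFamily h good) (p : ℕ) : word x p = 0 ↔ word y p = 0 := by
  unfold word
  by_cases hp : p / 2 ^ (3 * h) < 2 ^ (2 * h)
  · have := (shift_ne_zero_iff x ⟨_, hp⟩ (p % 2 ^ (3 * h))).trans
      (shift_ne_zero_iff y ⟨_, hp⟩ (p % 2 ^ (3 * h))).symm
    simp only [hp, dite_true]
    split_ifs <;> omega
  · simp [hp]

/-- In block `j` only the position that sends its displacement to colour `c` can match, and it does
so exactly when weighing `τ` counts that displacement. -/
theorem card_filter_eq (hh : 2 ≤ h) (M : Fin (2 ^ (2 * h)) → ℕ → Fin (2 ^ (2 * h)) → Prop)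
    (hM : ∀ j τ, ¬ M j 0 τ) (x : PermFamily h good) {c : ℕ} (hc : c < 2 ^ (3 * h))
    (τ : Fin (2 ^ (2 * h))) :
    ((Finset.range (2 ^ (5 * h))).filter fun p =>
      word x p = test M (((2 ^ (3 * h) * τ + c : ℕ) : ℤ) - p) ∧ word x p ≠ 0).card =
      Nat.card {j // M j (weight x c j) τ} := by
  classical
  rw [Nat.card_eq_fintype_card, Fintype.card_subtype]
  have hK := two_mul_two_pow hh
  have hlt : ∀ {j r}, shift x j r ≠ 0 → r < 2 ^ (3 * h) := fun hr => by
    have := ((shift_ne_zero_iff x _ _).1 hr).2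
    omega
  symm
  have hw : ∀ j ∈ Finset.univ.filter (fun j => M j (weight x c j) τ), weight x c j ≠ 0 := by
    intro j hj h0
    simp only [Finset.mem_filter, Finset.mem_univ, true_and, h0] at hj
    exact hM _ _ hj
  choose! f hf using fun j hj => exists_of_weight_ne_zero x (hw j hj)
  refine Finset.card_nbij (fun j => 2 ^ (3 * h) * j + f j) ?_ ?_ ?_
  · intro j hj
    obtain ⟨h1, h2, h3⟩ := hf j hj
    simp only [Finset.coe_filter, Finset.mem_univ, true_and, Set.mem_ofPred_eq] at hj
    simp only [Finset.coe_filter, Finset.mem_range, Set.mem_ofPred_eq]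
    rw [word_mul_add x j (hlt h1), if_neg h1, eq_test_iff hh M x hc j τ h1]
    exact ⟨mul_add_lt j (hlt h1), ⟨h2, h3 ▸ hj⟩, by omega⟩
  · intro j hj k hk hjk
    have h1 := congrArg (· / 2 ^ (3 * h)) hjk
    simp only [Nat.mul_add_div (show 0 < 2 ^ (3 * h) by positivity),
      Nat.div_eq_of_lt (hlt (hf j hj).1), Nat.div_eq_of_lt (hlt (hf k hk).1), add_zero] at h1
    exact Fin.ext h1
  · intro p hp
    simp only [Finset.coe_filter, Finset.mem_range, Set.mem_ofPred_eq] at hp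
    obtain ⟨hp, ht, h0⟩ := hp
    obtain ⟨j, r, hr, rfl⟩ := exists_eq_mul_add hp
    rw [word_mul_add x j hr] at ht h0
    have hs : shift x j r ≠ 0 := fun hs => h0 (if_pos hs)
    rw [if_neg hs, eq_test_iff hh M x hc j τ hs] at ht
    have hj : M j (weight x c j) τ := by rw [weight_eq x hs ht.1]; exact ht.2
    have hj' : j ∈ Finset.univ.filter (fun j => M j (weight x c j) τ) := by simpa using hj
    refine ⟨j, by simpa using hj, ?_⟩
    obtain ⟨h1, h2, -⟩ := hf j hj'
    simp only
    rw [add_shift_injOn x j h1 hs (by omega)]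

/-- Every displacement is delivered to some colour, and colour, block and displacement together give
back the position. -/
theorem eq_of_weight_eq (hh : 2 ≤ h) {x y : PermFamily h good}
    (hxy : ∀ c < 2 ^ (3 * h), weight x c = weight y c) : x = y := by
  apply shift_injective
  funext j r
  by_cases hs : shift x j r = 0
  · have := (shift_ne_zero_iff x j r).trans (shift_ne_zero_iff y j r).symm
    by_contra hne
    exact this.2 (fun h0 => hne (hs.trans h0.symm)) hs
  · have hK := two_mul_two_pow hh
    have h1 := residue_lt x j r
    have h2 := ((shift_ne_zero_iff x j r).1 hs).2
    have h3 := congrFun (hxy (r + 2 * 2 ^ (h - 2) * j + shift x j r) (by omega)) j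
    rw [weight_eq x hs rfl] at h3
    obtain ⟨r', h4, h5, h6⟩ := exists_of_weight_ne_zero y (h3 ▸ hs)
    have : r' = r := by omega
    subst this
    omega

/-- There are at least `2 ^ (4 * h)` permutations to choose, each in at least `(2 ^ (h - 3)) ^ 2 ^
(h - 3)` ways, and `4 * (h - 3) ≥ h` for `h ≥ 4`. -/
theorem pow_le_card_permFamily (hh : 4 ≤ h) (hgood : 2 ^ (2 * h) ≤ 2 * good.card) :
    2 ^ (2 ^ (5 * h - 5) * h) ≤ Fintype.card (PermFamily h good) := by
  rw [Fintype.card_fun, Fintype.card_perm, Fintype.card_fin, Fintype.card_prod, Fintype.card_coe,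
    Fintype.card_fin]
  obtain ⟨k, rfl⟩ := Nat.exists_eq_add_of_le hh
  have h1 : (2 ^ (k + 1)) ^ (2 ^ (k + 1)) ≤ (2 ^ (4 + k - 2)).factorial := by
    have := Nat.factorial_mul_pow_le_factorial (m := 2 ^ (k + 1)) (n := 2 ^ (k + 1))
    have he : 2 ^ (4 + k - 2) = 2 ^ (k + 1) + 2 ^ (k + 1) := by
      rw [← two_mul, ← pow_succ']; congr 1; omega
    rw [he]
    refine le_trans ?_ this
    refine (Nat.pow_le_pow_left (Nat.le_succ _) _).trans (Nat.le_mul_of_pos_left _ ?_)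
    exact Nat.factorial_pos _
  have h2 : 2 ^ (2 * (4 + k)) * 2 ^ (2 * (4 + k)) ≤ good.card * (2 * 2 ^ (2 * (4 + k))) := by
    calc _ ≤ 2 * good.card * 2 ^ (2 * (4 + k)) := Nat.mul_le_mul_right _ hgood
      _ = _ := by ring
  calc 2 ^ (2 ^ (5 * (4 + k) - 5) * (4 + k))
      ≤ 2 ^ ((k + 1) * 2 ^ (k + 1) * (2 ^ (2 * (4 + k)) * 2 ^ (2 * (4 + k)))) := by
        refine Nat.pow_le_pow_right (by norm_num) ?_
        have e1 : 2 ^ (5 * (4 + k) - 5) = 2 ^ (5 * k) * 2 ^ 15 := by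
          rw [← pow_add]; congr 1; omega
        have e2 : 2 ^ (k + 1) * (2 ^ (2 * (4 + k)) * 2 ^ (2 * (4 + k))) = 2 ^ (5 * k) * 2 ^ 17 := by
          rw [← pow_add, ← pow_add, ← pow_add]; congr 1; ring
        rw [mul_assoc, e1, e2]
        nlinarith [Nat.zero_le (2 ^ (5 * k)), Nat.zero_le (2 ^ (5 * k) * k)]
    _ = ((2 ^ (k + 1)) ^ (2 ^ (k + 1))) ^ (2 ^ (2 * (4 + k)) * 2 ^ (2 * (4 + k))) := by
        rw [← pow_mul, ← pow_mul, mul_assoc]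
    _ ≤ (2 ^ (4 + k - 2)).factorial ^ (2 ^ (2 * (4 + k)) * 2 ^ (2 * (4 + k))) :=
        Nat.pow_le_pow_left h1 _
    _ ≤ _ := Nat.pow_le_pow_right (Nat.factorial_pos _) h2

end CodeConstruction

open CodeConstruction in
/-- For alphabets of size at least `2 ^ (3 * h)` there is a gadget of length `2 ^ (5 * h)` whose
code has rate proportional to `h`. -/
theorem exists_gadget {q h : ℕ} (hh : 4 ≤ h) (hq : 2 ^ (3 * h) ≤ q) :
    ∃ Γ : Gadget q (5 * h), 2 ^ (2 ^ (5 * h - 5) * h) ≤ Fintype.card Γ.Index := by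
  obtain ⟨good, M, hgood, hM, hinj⟩ := exists_detecting_family h (by omega)
  have hK := two_mul_two_pow (h := h) (by omega)
  have hpos : 0 < 2 * 2 ^ (2 * h) * 2 ^ (h - 2) := by positivity
  refine ⟨{
    Index := PermFamily h good
    word := word
    test := test M
    word_lt := ?_
    test_lt := ?_
    test_eq_zero := ?_
    card_zero := ?_
    eq_of_card_eq := ?_ }, pow_le_card_permFamily hh hgood⟩
  · intro x p
    unfold word
    split_ifs with hp
    · omega
    · have := residue_lt x ⟨_, hp⟩ (p % 2 ^ (3 * h))
      dsimp only at this
      omega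
    · omega
  · intro d
    unfold test
    split_ifs with hex
    · obtain ⟨j, -, h1, -⟩ := hex
      have h2 : d % 2 ^ (3 * h) < 2 * 2 ^ (h - 2) * 2 ^ (2 * h) := by
        have h3 : (j : ℤ) + 1 ≤ 2 ^ (2 * h) := by exact_mod_cast j.isLt
        have h4 := Int.lt_mul_ediv_self_add (x := d % 2 ^ (3 * h))
          (show (0 : ℤ) < 2 * 2 ^ (h - 2) by positivity)
        rw [← h1] at h4
        have h5 : (2 * 2 ^ (h - 2) : ℤ) * (j + 1) ≤ 2 * 2 ^ (h - 2) * 2 ^ (2 * h) :=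
          mul_le_mul_of_nonneg_left h3 (by positivity)
        linarith
      have h6 : (2 * 2 ^ (h - 2) * 2 ^ (2 * h) : ℤ) =
          ((2 * 2 ^ (2 * h) * 2 ^ (h - 2) : ℕ) : ℤ) := by push_cast; ring
      rw [h6] at h2
      omega
    · omega
  · intro d hd
    unfold test
    rw [if_neg]
    rintro ⟨j, τ, -, h2, -⟩
    have hKpos : (0 : ℤ) < 2 ^ (3 * h) := by positivity
    have e : (2 ^ (5 * h) : ℤ) = 2 ^ (2 * h) * 2 ^ (3 * h) := by rw [← pow_add]; congr 1; ring
    have hj : (j : ℤ) + 1 ≤ 2 ^ (2 * h) := by exact_mod_cast j.isLt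
    have hτ : (τ : ℤ) + 1 ≤ 2 ^ (2 * h) := by exact_mod_cast τ.isLt
    rcases le_abs.1 hd with h3 | h3
    · have := (Int.le_ediv_iff_mul_le hKpos).2 (e ▸ h3)
      omega
    · have : d / 2 ^ (3 * h) < - 2 ^ (2 * h) + 1 := by
        rw [Int.ediv_lt_iff_lt_mul hKpos]
        nlinarith
      omega
  · intro x y
    simp only [word_eq_zero_iff x y]
  · intro x y hxy
    refine eq_of_weight_eq (by omega) fun c hc => ?_
    have hbound : ∀ (x : PermFamily h good) j, weight x c j ≤ 2 ^ (h - 1) := by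
      intro x j
      by_cases h0 : weight x c j = 0
      · rw [h0]; exact Nat.zero_le _
      · obtain ⟨r, -, -, h1⟩ := exists_of_weight_ne_zero x h0
        rw [h1]
        refine (shift_lt x j r).le.trans_eq ?_
        rw [← pow_succ']
        congr 1
        omega
    have hbad : ∀ (x : PermFamily h good), ∀ j ∉ good, weight x c j = 0 := by
      intro x j hj
      by_contra h0
      obtain ⟨r, h1, -⟩ := exists_of_weight_ne_zero x h0
      exact hj ((shift_ne_zero_iff x j r).1 h1).1
    refine hinj _ _ (hbound x) (hbound y) (fun j hj => by rw [hbad x j hj, hbad y j hj])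
      fun τ => ?_
    rw [← card_filter_eq (by omega) M hM x hc, ← card_filter_eq (by omega) M hM y hc]
    have h1 := hxy (2 ^ (3 * h) * τ + c) (mul_add_lt τ hc)
    -- The gadget counts all matches, the weighings only the nonzero ones; the difference does not
    -- depend on the code word.
    have hsplit : ∀ x : PermFamily h good,
        ((Finset.range (2 ^ (5 * h))).filter fun p =>
          word x p = test M (((2 ^ (3 * h) * τ + c : ℕ) : ℤ) - p)).card =
        ((Finset.range (2 ^ (5 * h))).filter fun p =>
          word x p = test M (((2 ^ (3 * h) * τ + c : ℕ) : ℤ) - p) ∧ word x p ≠ 0).card +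
        ((Finset.range (2 ^ (5 * h))).filter fun p =>
          word x p = 0 ∧ 0 = test M (((2 ^ (3 * h) * τ + c : ℕ) : ℤ) - p)).card := by
      intro x
      rw [← Finset.card_filter_add_card_filter_not (fun p => word x p ≠ 0),
        Finset.filter_filter, Finset.filter_filter]
      congr 2
      refine Finset.filter_congr fun p _ => ?_
      constructor
      · rintro ⟨h1, h2⟩; rw [not_not.1 h2] at h1; exact ⟨not_not.1 h2, h1⟩
      · rintro ⟨h1, h2⟩; exact ⟨h1.trans h2, not_not.2 h1⟩
    rw [hsplit x, hsplit y] at h1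
    simp only [word_eq_zero_iff x y] at h1
    exact Nat.add_right_cancel h1

end OnlineHamming

/-! ### The hard string and the hard streams. -/

namespace OnlineHamming

open CellProbe

theorem sum_range_mul_eq {M : Type*} [AddCommMonoid M] (f : ℕ → M) (m k : ℕ) :
    ∑ p ∈ Finset.range (m * k), f p =
      ∑ j ∈ Finset.range k, ∑ r ∈ Finset.range m, f (m * j + r) := by
  induction k with
  | zero => simp
  | succ k ih => rw [Nat.mul_succ, Finset.sum_range_add, ih, Finset.sum_range_succ]

/-- The contribution of `S₀` does not depend on the stream and cancels between streams; this is why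
one `F` serves all initial windows. -/
theorem hammingDist_window {q n : ℕ} (G : ℕ → ℕ) (F S₀ U : Fin n → Fin q)
    (hF : ∀ i, (F i : ℕ) = G (n - 1 - i)) (u : ℕ → ℕ) (hu : ∀ p : Fin n, (U p : ℕ) = u p)
    (t : Fin n) :
    hammingDist F (window S₀ U t) =
      (Finset.univ.filter fun i : Fin n => ∃ h : t.val + 1 + i.val < n,
        F i ≠ S₀ ⟨t.val + 1 + i.val, h⟩).card +
      ((Finset.range (t + 1)).filter fun p => u p ≠ G (t - p)).card := by
  classical
  have hW1 : ∀ i : Fin n, ∀ h : t.val + 1 + i.val < n,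
      window S₀ U t i = S₀ ⟨t.val + 1 + i.val, h⟩ := by
    intro i h
    exact Fin.append_left S₀ U ⟨t.val + 1 + i.val, h⟩
  have hW2 : ∀ i : Fin n, ∀ h : ¬ t.val + 1 + i.val < n,
      (window S₀ U t i : ℕ) = u (t.val + 1 + i.val - n) := by
    intro i h
    have h1 : t.val + 1 + i.val - n < n := by omega
    have h2 := Fin.append_right S₀ U ⟨t.val + 1 + i.val - n, h1⟩
    have h3 : Fin.natAdd n ⟨t.val + 1 + i.val - n, h1⟩ =
        (⟨t.val + 1 + i.val, by omega⟩ : Fin (n + n)) := by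
      ext; simp; omega
    rw [h3] at h2
    rw [window, h2, hu]
  unfold hammingDist
  rw [← Finset.card_filter_add_card_filter_not (fun i : Fin n => t.val + 1 + i.val < n),
    Finset.filter_filter, Finset.filter_filter]
  congr 1
  · congr 1
    refine Finset.filter_congr fun i _ => ?_
    constructor
    · rintro ⟨h1, h2⟩; rw [hW1 i h2] at h1; exact ⟨h2, h1⟩
    · rintro ⟨h2, h1⟩; rw [hW1 i h2]; exact ⟨h1, h2⟩
  · refine Finset.card_nbij (fun i => t.val + 1 + i.val - n) ?_ ?_ ?_
    · intro i hi
      simp only [Finset.coe_filter, Finset.mem_univ, true_and, Set.mem_ofPred_eq,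
        Finset.mem_range] at hi ⊢
      obtain ⟨h1, h2⟩ := hi
      refine ⟨by omega, fun h3 => h1 (Fin.ext ?_)⟩
      rw [hW2 i h2, h3, hF]
      congr 1
      omega
    · intro i hi j hj hij
      simp only [Finset.coe_filter, Finset.mem_univ, true_and, Set.mem_ofPred_eq] at hi hj
      ext
      dsimp only at hij
      omega
    · intro p hp
      simp only [Finset.coe_filter, Set.mem_ofPred_eq, Finset.mem_range] at hp
      have ht := t.isLt
      have hlt : ¬ t.val + 1 + (p + n - 1 - t) < n := by omega
      refine ⟨⟨p + n - 1 - t, by omega⟩, ?_, by simp only; omega⟩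
      simp only [Finset.coe_filter, Finset.mem_univ, true_and, Set.mem_ofPred_eq]
      refine ⟨fun h => hp.2 ?_, hlt⟩
      have h1 := hW2 ⟨p + n - 1 - t, by omega⟩ hlt
      rw [← h, hF] at h1
      convert h1.symm using 2 <;> simp only <;> omega

/-- Equal distances mean equal numbers of matches in the part of the window that has arrived. -/
theorem sum_matches_sub_eq_zero {q n : ℕ} (G : ℕ → ℕ) (F S₀ U V : Fin n → Fin q)
    (hF : ∀ i, (F i : ℕ) = G (n - 1 - i)) (u v : ℕ → ℕ) (hu : ∀ p : Fin n, (U p : ℕ) = u p)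
    (hv : ∀ p : Fin n, (V p : ℕ) = v p) (t : Fin n)
    (h : hammingDist F (window S₀ U t) = hammingDist F (window S₀ V t)) :
    ∑ p ∈ Finset.range (t + 1), ((if u p = G (t - p) then (1 : ℤ) else 0) -
      (if v p = G (t - p) then (1 : ℤ) else 0)) = 0 := by
  rw [hammingDist_window G F S₀ U hF u hu, hammingDist_window G F S₀ V hF v hv,
    Nat.add_left_cancel_iff] at h
  have h1 := Finset.card_filter_add_card_filter_not (s := Finset.range (t + 1))
    (fun p => u p = G (t - p))
  have h2 := Finset.card_filter_add_card_filter_not (s := Finset.range (t + 1))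
    (fun p => v p = G (t - p))
  rw [Finset.sum_sub_distrib, Finset.sum_boole, Finset.sum_boole, sub_eq_zero]
  norm_cast
  simp only [ne_eq] at h
  omega

namespace Gadget

variable {q b : ℕ} (Γ : Gadget q b)

/-- The symbols of the stream composed of the code words `φ`, with gaps of the same length. -/
def stream {N : ℕ} (φ : Fin N → Γ.Index) (p : ℕ) : ℕ :=
  if h : p / 2 ^ (b + 1) < N then
    if p % 2 ^ (b + 1) < 2 ^ b then Γ.word (φ ⟨p / 2 ^ (b + 1), h⟩) (p % 2 ^ (b + 1)) else 0
  else 0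

/-- The symbol of the fixed string that is compared with the symbol that arrived `d` steps ago:
a copy of the test string is placed around each power of two. -/
def lagSymbol (d : ℕ) : ℕ := Γ.test ((d : ℤ) - 2 ^ Nat.log 2 (4 * d / 3))

/-- The factor `4 / 3` in `lagSymbol` moves the change of scale from `2 ^ i` to `3 / 4 * 2 ^ i`,
which leaves room on both sides of lag `2 ^ i`. -/
theorem lagSymbol_eq {i d : ℕ} (h1 : 3 * 2 ^ i ≤ 4 * d) (h2 : 4 * d < 6 * 2 ^ i) :
    Γ.lagSymbol d = Γ.test ((d : ℤ) - 2 ^ i) := by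
  rw [lagSymbol, Nat.log_eq_of_pow_le_of_lt_pow (m := i)]
  · omega
  · rw [pow_succ]; omega

theorem stream_lt (hq : 0 < q) {N : ℕ} (φ : Fin N → Γ.Index) (p : ℕ) : Γ.stream φ p < q := by
  unfold stream
  split_ifs
  · exact Γ.word_lt _ _
  · exact hq
  · exact hq

/-- The fixed string of the hard instance. -/
def pattern (n : ℕ) (i : Fin n) : Fin q := ⟨Γ.lagSymbol (n - 1 - i), Γ.test_lt _⟩

theorem stream_mul_add {N : ℕ} (φ : Fin N → Γ.Index) (k : Fin N) {r : ℕ}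
    (hr : r < 2 ^ (b + 1)) :
    Γ.stream φ (2 ^ (b + 1) * k + r) = if r < 2 ^ b then Γ.word (φ k) r else 0 := by
  have h1 : (2 ^ (b + 1) * k + r) / 2 ^ (b + 1) = k := by
    rw [Nat.mul_add_div (by positivity), Nat.div_eq_of_lt hr, add_zero]
  have h2 : (2 ^ (b + 1) * k + r) % 2 ^ (b + 1) = r := by
    rw [Nat.mul_add_mod, Nat.mod_eq_of_lt hr]
  simp only [stream, h1, h2, k.isLt, dite_true, Fin.eta]

theorem stream_congr {N : ℕ} {φ ψ : Fin N → Γ.Index} {p : ℕ}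
    (h : ∀ k : Fin N, k.val = p / 2 ^ (b + 1) → φ k = ψ k) : Γ.stream φ p = Γ.stream ψ p := by
  unfold stream
  split_ifs with h1 h2
  · rw [h ⟨_, h1⟩ rfl]
  · rfl
  · rfl

/-- The matches in one block of the first quarter of a period, one period later. -/
theorem sum_block {N : ℕ} (φ ψ : Fin N → Γ.Index) (e v : ℕ) {k k' : Fin N} {s : ℕ}
    (hk : 2 ^ (e + 3) * v ≤ k.val ∧ k.val < 2 ^ (e + 3) * v + 2 ^ e)
    (hk' : 2 ^ (e + 3) * v ≤ k'.val ∧ k'.val < 2 ^ (e + 3) * v + 2 ^ e) (hs : s < 2 ^ b) :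
    ∑ r ∈ Finset.range (2 ^ (b + 1)),
      ((if Γ.stream φ (2 ^ (b + 1) * k' + r) =
          Γ.lagSymbol (2 ^ (b + 3 + e) + 2 ^ (b + 1) * k + s - (2 ^ (b + 1) * k' + r))
        then (1 : ℤ) else 0) -
      (if Γ.stream ψ (2 ^ (b + 1) * k' + r) =
          Γ.lagSymbol (2 ^ (b + 3 + e) + 2 ^ (b + 1) * k + s - (2 ^ (b + 1) * k' + r))
        then (1 : ℤ) else 0)) =
    ∑ r ∈ Finset.range (2 ^ b),
      ((if Γ.word (φ k') r = Γ.test ((2 ^ (b + 1) * ((k : ℤ) - k')) + (s - r)) then (1 : ℤ) else 0) -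
      (if Γ.word (ψ k') r = Γ.test ((2 ^ (b + 1) * ((k : ℤ) - k')) + (s - r))
        then (1 : ℤ) else 0)) := by
  have e2 : 2 ^ (b + 1) = 2 ^ b + 2 ^ b := by rw [pow_succ]; ring
  rw [e2, Finset.sum_range_add, ← e2]
  rw [Finset.sum_eq_zero (s := Finset.range (2 ^ b))
    (f := fun x => (if Γ.stream φ (2 ^ (b + 1) * k' + (2 ^ b + x)) =
          Γ.lagSymbol (2 ^ (b + 3 + e) + 2 ^ (b + 1) * k + s - (2 ^ (b + 1) * k' + (2 ^ b + x)))
        then (1 : ℤ) else 0) -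
      (if Γ.stream ψ (2 ^ (b + 1) * k' + (2 ^ b + x)) =
          Γ.lagSymbol (2 ^ (b + 3 + e) + 2 ^ (b + 1) * k + s - (2 ^ (b + 1) * k' + (2 ^ b + x)))
        then (1 : ℤ) else 0)), add_zero]
  · refine Finset.sum_congr rfl fun r hr => ?_
    rw [Finset.mem_range] at hr
    rw [Γ.stream_mul_add φ k' (by omega), Γ.stream_mul_add ψ k' (by omega), if_pos hr, if_pos hr]
    have e3 : 2 ^ (b + 3 + e) = 2 ^ b * (8 * 2 ^ e) := by rw [pow_add, pow_add]; ring
    have e4 : 2 ^ (b + 1) = 2 ^ b * 2 := by rw [pow_succ]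
    have hb : 0 < 2 ^ b := by positivity
    have hE : 0 < 2 ^ e := by positivity
    -- Blocks of the first quarter are at most `E = 2 ^ e - 1` apart; the missing block absorbs `s -
    -- r`, so lags stay within a quarter of `2 ^ (b + 3 + e)`.
    obtain ⟨E, hE'⟩ : ∃ E, 2 ^ e = E + 1 := ⟨2 ^ e - 1, by omega⟩
    rw [hE'] at hk hk' e3
    have hkk : k.val ≤ k'.val + E := by omega
    have hkk' : k'.val ≤ k.val + E := by omega
    have hm := Nat.mul_le_mul_left (2 ^ b * 2) hkk
    have hm' := Nat.mul_le_mul_left (2 ^ b * 2) hkk'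
    have hlag : Γ.lagSymbol (2 ^ (b + 3 + e) + 2 ^ (b + 1) * k + s - (2 ^ (b + 1) * k' + r)) =
        Γ.test ((2 ^ (b + 1) * ((k : ℤ) - k')) + (s - r)) := by
      have hle : 2 ^ (b + 1) * k' + r ≤ 2 ^ (b + 3 + e) + 2 ^ (b + 1) * k + s := by
        rw [e3, e4]
        nlinarith [Nat.zero_le (2 ^ b * E)]
      rw [Γ.lagSymbol_eq (i := b + 3 + e)]
      · congr 1
        rw [Nat.cast_sub hle]
        push_cast
        ring
      · zify [hle]
        zify at e3 e4 hm hm' hr hs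
        rw [e3, e4]
        nlinarith [mul_nonneg (show (0 : ℤ) ≤ 2 ^ b by positivity) (Int.natCast_nonneg E)]
      · zify [hle]
        zify at e3 e4 hm hm' hr hs
        rw [e3, e4]
        nlinarith [mul_nonneg (show (0 : ℤ) ≤ 2 ^ b by positivity) (Int.natCast_nonneg E)]
    rw [hlag]
  · intro r hr
    rw [Finset.mem_range] at hr
    rw [Γ.stream_mul_add φ k' (by omega), Γ.stream_mul_add ψ k' (by omega)]
    simp

/-- The distances during a period determine the code words in the first quarter of the period
before. -/
theorem eq_of_hammingDist_eq (hq : 0 < q) {n N : ℕ} (S₀ : Fin n → Fin q) (φ ψ : Fin N → Γ.Index)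
    (e v : ℕ) (hn : 2 ^ (b + 3 + e + 1) * (v + 1) ≤ n)
    (hagree : ∀ k : Fin N, ¬ (2 ^ (e + 3) * v ≤ k.val ∧ k.val < 2 ^ (e + 3) * v + 2 ^ e) →
      φ k = ψ k)
    (h : ∀ t : Fin n, 2 ^ (b + 3 + e + 1) * v + 2 ^ (b + 3 + e) ≤ t.val →
      t.val < 2 ^ (b + 3 + e + 1) * v + 2 ^ (b + 3 + e) + 2 ^ (b + 3 + e) →
      hammingDist (Γ.pattern n) (window S₀ (fun p => ⟨Γ.stream φ p, Γ.stream_lt hq φ p⟩) t) =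
      hammingDist (Γ.pattern n) (window S₀ (fun p => ⟨Γ.stream ψ p, Γ.stream_lt hq ψ p⟩) t)) :
    φ = ψ := by
  funext k
  by_cases hk : 2 ^ (e + 3) * v ≤ k.val ∧ k.val < 2 ^ (e + 3) * v + 2 ^ e
  swap
  · exact hagree k hk
  refine Γ.eq_of_card_eq _ _ fun s hs => ?_
  have e1 : 2 ^ (b + 3 + e + 1) * v = 2 ^ (b + 1) * (2 ^ (e + 3) * v) := by
    rw [← mul_assoc, ← pow_add]; congr 2; ring
  have e2 : 2 ^ (b + 3 + e + 1) = 2 ^ (b + 3 + e) + 2 ^ (b + 3 + e) := by rw [pow_succ]; ring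
  have e3 : 2 ^ (b + 1) * (2 ^ (e + 3) * v + 2 ^ e) =
      2 ^ (b + 1) * (2 ^ (e + 3) * v) + 2 ^ (b + 1 + e) := by rw [mul_add, ← pow_add]
  have e4 : 2 ^ (b + 3 + e) = 4 * 2 ^ (b + 1 + e) := by
    rw [show b + 3 + e = b + 1 + e + 2 by ring, pow_succ, pow_succ]; ring
  have hsb : s < 2 ^ (b + 1) := hs.trans (Nat.pow_lt_pow_right (by norm_num) (by omega))
  have hk1 : 2 ^ (b + 1) * (2 ^ (e + 3) * v) ≤ 2 ^ (b + 1) * k := Nat.mul_le_mul_left _ hk.1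
  have hk2 : 2 ^ (b + 1) * (k.val + 1) ≤ 2 ^ (b + 1) * (2 ^ (e + 3) * v + 2 ^ e) :=
    Nat.mul_le_mul_left _ hk.2
  rw [mul_add _ k.val, mul_one] at hk2
  rw [mul_add, mul_one] at hn
  have ht : 2 ^ (b + 3 + e) + 2 ^ (b + 1) * k + s < n := by omega
  have h0 := sum_matches_sub_eq_zero Γ.lagSymbol (Γ.pattern n) S₀ _ _ (fun i => rfl)
    (Γ.stream φ) (Γ.stream ψ) (fun p => rfl) (fun p => rfl)
    ⟨2 ^ (b + 3 + e) + 2 ^ (b + 1) * k + s, ht⟩ (h _ (by simp only; omega) (by simp only; omega))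
  simp only at h0
  -- After the first quarter the streams agree, so those symbols cancel.
  have hsub : Finset.range (2 ^ (b + 1) * (2 ^ (e + 3) * v + 2 ^ e)) ⊆
      Finset.range (2 ^ (b + 3 + e) + 2 ^ (b + 1) * k + s + 1) :=
    Finset.range_subset_range.2 (by omega)
  rw [← Finset.sum_subset hsub, sum_range_mul_eq, Finset.sum_eq_single k.val] at h0
  · rw [Γ.sum_block φ ψ e v hk hk hs, Finset.sum_sub_distrib, Finset.sum_boole, Finset.sum_boole,
      sub_eq_zero] at h0
    simp only [sub_self, mul_zero, zero_add] at h0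
    exact_mod_cast h0
  · intro k' hk' hne
    rw [Finset.mem_range] at hk'
    by_cases hN : k' < N ∧ 2 ^ (e + 3) * v ≤ k'
    · have hsum := Γ.sum_block φ ψ e v (k := k) (k' := ⟨k', hN.1⟩) hk ⟨hN.2, hk'⟩ hs
      simp only at hsum
      rw [hsum]
      -- The gaps between code words push every other block out of the range of the test string.
      have hz : ∀ r ∈ Finset.range (2 ^ b),
          Γ.test ((2 ^ (b + 1) * ((k : ℤ) - k')) + (s - r)) = 0 := by
        intro r hr
        rw [Finset.mem_range] at hr
        refine Γ.test_eq_zero _ ?_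
        have hb : (0 : ℤ) < 2 ^ b := by positivity
        have hr' : (r : ℤ) < 2 ^ b := by exact_mod_cast hr
        have hs' : (s : ℤ) < 2 ^ b := by exact_mod_cast hs
        rw [pow_succ]
        rcases lt_or_gt_of_ne hne with h1 | h1
        · have : (1 : ℤ) ≤ (k : ℤ) - k' := by omega
          refine le_abs.2 (Or.inl ?_)
          nlinarith
        · have : (k : ℤ) - k' ≤ -1 := by omega
          refine le_abs.2 (Or.inr ?_)
          nlinarith
      rw [Finset.sum_congr rfl fun r hr => by rw [hz r hr], Finset.sum_sub_distrib,
        Finset.sum_boole, Finset.sum_boole, Γ.card_zero (φ ⟨k', hN.1⟩) (ψ ⟨k', hN.1⟩), sub_self]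
    · refine Finset.sum_eq_zero fun r hr => ?_
      rw [Finset.mem_range] at hr
      rw [Γ.stream_congr (φ := φ) (ψ := ψ), sub_self]
      intro j hj
      rw [Nat.mul_add_div (by positivity), Nat.div_eq_of_lt hr, add_zero] at hj
      exact hagree j fun hj' => hN ⟨hj ▸ j.isLt, hj ▸ hj'.1⟩
  · intro hk'
    exact absurd (Finset.mem_range.2 hk.2) hk'
  · intro p _ hp
    rw [Finset.mem_range, not_lt] at hp
    rw [Γ.stream_congr (φ := φ) (ψ := ψ), sub_self]
    intro j hj
    refine hagree j fun hj' => ?_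
    have := Nat.div_le_div_right (c := 2 ^ (b + 1)) hp
    rw [Nat.mul_div_cancel_left _ (by positivity)] at this
    omega

/-- Few of the hard streams have a small transfer between two consecutive periods. -/
theorem card_transfer_le (hq : 0 < q) {n N s w : ℕ} (S₀ : Fin n → Fin q)
    (A : Algorithm q n s w) (hA : Correct (Γ.pattern n) S₀ A) (e v M : ℕ)
    (hn : 2 ^ (b + 3 + e + 1) * (v + 1) ≤ n) (hN : n ≤ 2 ^ (b + 1) * N) :
    (Finset.univ.filter fun φ : Fin N → Γ.Index =>
        (A.transfer (fun p => ⟨Γ.stream φ p, Γ.stream_lt hq φ p⟩) (b + 3 + e) v).card ≤ M).card *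
      Fintype.card Γ.Index ^ 2 ^ e ≤
      Fintype.card (Fin N → Γ.Index) * (s * 2 ^ w + 1) ^ M := by
  classical
  let I : Finset (Fin N) := Finset.univ.filter fun k =>
    2 ^ (e + 3) * v ≤ k.val ∧ k.val < 2 ^ (e + 3) * v + 2 ^ e
  have e1 : 2 ^ (b + 3 + e + 1) * v = 2 ^ (b + 1) * (2 ^ (e + 3) * v) := by
    rw [← mul_assoc, ← pow_add]; congr 2; ring
  have e3 : 2 ^ (b + 1) * (2 ^ (e + 3) * v + 2 ^ e) =
      2 ^ (b + 1) * (2 ^ (e + 3) * v) + 2 ^ (b + 1 + e) := by rw [mul_add, ← pow_add]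
  have e4 : 2 ^ (b + 3 + e) = 4 * 2 ^ (b + 1 + e) := by
    rw [show b + 3 + e = b + 1 + e + 2 by ring, pow_succ, pow_succ]; ring
  have e5 : 2 ^ (b + 3 + e + 1) = 8 * 2 ^ (b + 1 + e) := by rw [pow_succ, e4]; ring
  have hlast : 2 ^ (e + 3) * v + 2 ^ e ≤ N := by
    refine le_of_mul_le_mul_left (a := 2 ^ (b + 1)) ?_ (by positivity)
    rw [mul_add, mul_one] at hn
    omega
  have hI : I.card = 2 ^ e := by
    have : I.map Fin.valEmbedding = Finset.Ico (2 ^ (e + 3) * v) (2 ^ (e + 3) * v + 2 ^ e) := by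
      ext k
      simp only [Finset.mem_map, Fin.valEmbedding_apply, Finset.mem_Ico, I, Finset.mem_filter,
        Finset.mem_univ, true_and]
      constructor
      · rintro ⟨j, hj, rfl⟩; exact hj
      · intro hk; exact ⟨⟨k, by omega⟩, hk, rfl⟩
    rw [← Finset.card_map, this, Nat.card_Ico, Nat.add_sub_cancel_left]
  have hcard : Fintype.card ({k // k ∉ I} → Γ.Index) * Fintype.card Γ.Index ^ 2 ^ e =
      Fintype.card (Fin N → Γ.Index) := by
    rw [Fintype.card_fun, Fintype.card_fun, ← pow_add, Fintype.card_subtype_compl,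
      Fintype.card_coe, hI, Fintype.card_fin]
    congr 1
    omega
  -- The words outside the first quarter are given for free; the `2 ^ e` words inside must be
  -- encoded by the transfer.
  have h := A.card_transfer_le (Φ := Fin N → Γ.Index) (Y := {k // k ∉ I} → Γ.Index)
    (fun φ p => ⟨Γ.stream φ p, Γ.stream_lt hq φ p⟩) (fun φ k => φ k) (b + 3 + e) v M ?_ ?_
  · calc _ ≤ _ := Nat.mul_le_mul_right _ h
      _ = _ := by rw [← hcard]; ring
  · intro φ ψ hφψ t ht
    refine Fin.ext (Γ.stream_congr fun k hk => congrFun hφψ ⟨k, fun hkI => ht ?_⟩)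
    simp only [I, Finset.mem_filter, Finset.mem_univ, true_and] at hkI
    rw [hk, Nat.le_div_iff_mul_le (by positivity), Nat.div_lt_iff_lt_mul (by positivity)] at hkI
    rw [Finset.mem_Ico]
    rw [mul_comm, mul_comm _ (2 ^ (b + 1)), e3] at hkI
    omega
  · intro φ ψ hφψ hout
    refine Γ.eq_of_hammingDist_eq hq S₀ φ ψ e v hn (fun k hk => ?_) fun t h1 h2 => ?_
    · exact congrFun hφψ ⟨k, by simpa [I] using hk⟩
    · rw [← hA, ← hA]
      exact hout t h1 h2

end Gadget

end OnlineHamming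

/-! ### From deterministic to randomised algorithms. -/

namespace CellProbe

/-- The easy direction of Yao's principle. -/
theorem RandomisedAlgorithm.exists_le_expectedProbes {q n s w : ℕ} {Φ : Type*} [Fintype Φ]
    [Nonempty Φ] (U : Φ → Fin n → Fin q) (P : RandomisedAlgorithm q n s w) {x : ℝ}
    (h : ∀ A ∈ P.support, x * Fintype.card Φ ≤ ((∑ φ, A.totalProbes (U φ) : ℕ) : ℝ)) :
    ∃ φ, ENNReal.ofReal x ≤ P.expectedProbes (U φ) := by
  by_contra! hlt
  have h1 : ∑ φ, P.expectedProbes (U φ) < ∑ _φ : Φ, ENNReal.ofReal x :=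
    ENNReal.sum_lt_sum_of_nonempty Finset.univ_nonempty fun φ _ => hlt φ
  refine absurd h1 (not_lt.2 ?_)
  have h2 : ∑ φ, P.expectedProbes (U φ) =
      ∑' A, P A * ((∑ φ, A.totalProbes (U φ) : ℕ) : ℝ≥0∞) := by
    simp only [RandomisedAlgorithm.expectedProbes]
    rw [← Summable.tsum_finsetSum fun _ _ => ENNReal.summable]
    simp only [Nat.cast_sum, Finset.mul_sum]
  rw [h2, Finset.sum_const, Finset.card_univ, nsmul_eq_mul]
  calc (Fintype.card Φ : ℝ≥0∞) * ENNReal.ofReal x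
      = ∑' A, P A * (Fintype.card Φ * ENNReal.ofReal x) := by
        rw [ENNReal.tsum_mul_right, P.tsum_coe, one_mul]
    _ ≤ _ := by
        refine ENNReal.tsum_le_tsum fun A => ?_
        by_cases hA : P A = 0
        · simp [hA]
        · refine mul_le_mul_right ?_ _
          have h3 := ENNReal.ofReal_le_ofReal (h A ((P.mem_support_iff A).2 hA))
          rwa [ENNReal.ofReal_natCast, mul_comm, ENNReal.ofReal_mul (Nat.cast_nonneg _),
            ENNReal.ofReal_natCast] at h3

end CellProbe

/-! ### Choice of parameters and summation over all scales. -/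

namespace OnlineHamming

open CellProbe

theorem delta_le_of_left_le {q n d : ℕ} (hq : 0 < q) (h : q ≤ 2 ^ d) : delta q n ≤ d := by
  refine Nat.ceil_le.2 ((min_le_left _ _).trans ?_)
  rw [Real.logb_le_iff_le_rpow (by norm_num) (by exact_mod_cast hq), Real.rpow_natCast]
  exact_mod_cast h

theorem delta_le_of_right_le {q n d : ℕ} (hn : 0 < n) (h : n ≤ 2 ^ d) : delta q n ≤ d := by
  refine Nat.ceil_le.2 ((min_le_right _ _).trans ?_)
  rw [Real.logb_le_iff_le_rpow (by norm_num) (by exact_mod_cast hn), Real.rpow_natCast]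
  exact_mod_cast h

/-- There is a short gadget whose code has rate proportional to `δ`. -/
theorem exists_gadget_delta {q n : ℕ} (hq : 2 ≤ q) (hn : 2 ^ 80 ≤ n) :
    ∃ (b r : ℕ) (Γ : Gadget q b), 0 < r ∧ 2 ^ r ≤ Fintype.card Γ.Index ∧ 4 * b ≤ Nat.log 2 n ∧
      delta q n * 2 ^ b ≤ 800 * r := by
  have hlog : 80 ≤ Nat.log 2 n := Nat.le_log_of_pow_le (by norm_num) hn
  have hδq : delta q n ≤ Nat.log 2 q + 1 :=
    delta_le_of_left_le (by omega) (Nat.lt_pow_succ_log_self (by norm_num) q).le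
  have hδn : delta q n ≤ Nat.log 2 n + 1 :=
    delta_le_of_right_le (by omega) (Nat.lt_pow_succ_log_self (by norm_num) n).le
  by_cases hh : 4 ≤ Nat.log 2 q / 3
  -- `3 * h` must fit the alphabet, and `20 * h = 4 * b` keeps the gadget at most `n ^ (1 / 4)`
  -- long.
  · obtain ⟨h, h1, h2, h3, h4⟩ : ∃ h, 4 ≤ h ∧ 3 * h ≤ Nat.log 2 q ∧ 20 * h ≤ Nat.log 2 n ∧
        delta q n ≤ 25 * h := by
      rcases le_total (Nat.log 2 q / 3) (Nat.log 2 n / 20) with hle | hle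
      · exact ⟨Nat.log 2 q / 3, by omega, by omega, by omega, by omega⟩
      · exact ⟨Nat.log 2 n / 20, by omega, by omega, by omega, by omega⟩
    obtain ⟨Γ, hΓ⟩ := exists_gadget (q := q) h1
      ((Nat.pow_le_pow_right (by norm_num) h2).trans (Nat.pow_log_le_self 2 (by omega)))
    refine ⟨5 * h, 2 ^ (5 * h - 5) * h, Γ, by positivity, hΓ, by omega, ?_⟩
    have e : 2 ^ (5 * h) = 2 ^ (5 * h - 5) * 32 := by
      rw [show (32 : ℕ) = 2 ^ 5 by norm_num, ← pow_add]; congr 1; omega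
    calc delta q n * 2 ^ (5 * h) ≤ 25 * h * 2 ^ (5 * h) := Nat.mul_le_mul_right _ h4
      _ = 800 * (2 ^ (5 * h - 5) * h) := by rw [e]; ring
  -- Here `q < 2 ^ 12`, so `δ` is bounded and one bit per code word suffices.
  · refine ⟨1, 1, binaryGadget q hq, one_pos, le_of_eq rfl, by omega, ?_⟩
    omega

namespace Gadget

variable {q b : ℕ} (Γ : Gadget q b)

/-- The average transfer between two periods is large. -/
theorem card_mul_le_sum_transfer (hq : 0 < q) {n N s w κ r : ℕ} (hw : 0 < w)
    (hs : s ≤ 2 ^ (κ * w)) (hr : 0 < r) (hΓ : 2 ^ r ≤ Fintype.card Γ.Index) (S₀ : Fin n → Fin q)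
    (A : Algorithm q n s w) (hA : Correct (Γ.pattern n) S₀ A) (e v : ℕ)
    (hn : 2 ^ (b + 3 + e + 1) * (v + 1) ≤ n) (hN : n ≤ 2 ^ (b + 1) * N) :
    Fintype.card (Fin N → Γ.Index) * (r * 2 ^ e) ≤ 2 * ((κ + 2) * w) *
      ∑ φ : Fin N → Γ.Index,
        (A.transfer (fun p => ⟨Γ.stream φ p, Γ.stream_lt hq φ p⟩) (b + 3 + e) v).card := by
  classical
  set τ : (Fin N → Γ.Index) → ℕ := fun φ =>
    (A.transfer (fun p => ⟨Γ.stream φ p, Γ.stream_lt hq φ p⟩) (b + 3 + e) v).card with hτ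
  have hpos : 0 < (κ + 2) * w := by positivity
  -- Patches of `M` cells carry at most `r * 2 ^ e - 1` bits, one fewer than the code words, so at
  -- most half of the streams have transfer at most `M`.
  set M := (r * 2 ^ e - 1) / ((κ + 2) * w) with hM
  have hre : 0 < r * 2 ^ e := by positivity
  have hM1 : r * 2 ^ e ≤ (κ + 2) * w * (M + 1) := by
    have := Nat.lt_mul_div_succ (r * 2 ^ e - 1) hpos
    rw [← hM] at this
    omega
  have hM2 : (κ + 2) * w * M ≤ r * 2 ^ e - 1 := Nat.mul_div_le _ _
  have hfew := Γ.card_transfer_le hq S₀ A hA e v M hn hN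
  -- A patch entry takes `κ * w` bits of address and `w` of content; one more bit pays for the
  -- padding symbol.
  have hcell : s * 2 ^ w + 1 ≤ 2 ^ ((κ + 2) * w) := by
    have h1 : s * 2 ^ w ≤ 2 ^ (κ * w + w) := by
      rw [pow_add]; exact Nat.mul_le_mul_right _ hs
    have h2 : 2 ^ (κ * w + w + 1) ≤ 2 ^ ((κ + 2) * w) :=
      Nat.pow_le_pow_right (by norm_num) (by rw [add_mul]; omega)
    have h3 : 0 < 2 ^ (κ * w + w) := by positivity
    rw [pow_succ] at h2
    omega
  have hhalf : 2 * (s * 2 ^ w + 1) ^ M ≤ Fintype.card Γ.Index ^ 2 ^ e :=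
    calc 2 * (s * 2 ^ w + 1) ^ M ≤ 2 * 2 ^ ((κ + 2) * w * M) := by
          rw [pow_mul]; exact Nat.mul_le_mul_left _ (Nat.pow_le_pow_left hcell _)
      _ ≤ 2 * 2 ^ (r * 2 ^ e - 1) :=
          Nat.mul_le_mul_left _ (Nat.pow_le_pow_right (by norm_num) hM2)
      _ = (2 ^ r) ^ 2 ^ e := by rw [← pow_succ', ← pow_mul]; congr 1; omega
      _ ≤ _ := Nat.pow_le_pow_left hΓ _
  have hfew' : 2 * (Finset.univ.filter fun φ => τ φ ≤ M).card ≤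
      Fintype.card (Fin N → Γ.Index) := by
    refine le_of_mul_le_mul_right (a := (s * 2 ^ w + 1) ^ M) ?_ (by positivity)
    refine le_trans ?_ hfew
    calc _ = (Finset.univ.filter fun φ => τ φ ≤ M).card * (2 * (s * 2 ^ w + 1) ^ M) := by ring
      _ ≤ _ := Nat.mul_le_mul_left _ hhalf
  have hsum : (Finset.univ.filter fun φ => ¬ τ φ ≤ M).card * (M + 1) ≤ ∑ φ, τ φ := by
    rw [← smul_eq_mul]
    refine (Finset.card_nsmul_le_sum _ τ _ fun φ hφ => ?_).trans
      (Finset.sum_le_sum_of_subset (Finset.filter_subset _ _))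
    simp only [Finset.mem_filter, Finset.mem_univ, true_and] at hφ
    omega
  have hcompl := Finset.card_filter_add_card_filter_not
    (s := (Finset.univ : Finset (Fin N → Γ.Index))) (fun φ => τ φ ≤ M)
  rw [Finset.card_univ] at hcompl
  calc Fintype.card (Fin N → Γ.Index) * (r * 2 ^ e)
      ≤ (2 * (Finset.univ.filter fun φ => ¬ τ φ ≤ M).card) * ((κ + 2) * w * (M + 1)) :=
        Nat.mul_le_mul (by omega) hM1
    _ = 2 * ((κ + 2) * w) * ((Finset.univ.filter fun φ => ¬ τ φ ≤ M).card * (M + 1)) := by ring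
    _ ≤ _ := Nat.mul_le_mul_left _ hsum

/-- The average number of probes on the hard streams is large. -/
theorem card_mul_le_sum_totalProbes (hq : 0 < q) {n N s w κ r : ℕ} (hw : 0 < w)
    (hs : s ≤ 2 ^ (κ * w)) (hr : 0 < r) (hΓ : 2 ^ r ≤ Fintype.card Γ.Index) (S₀ : Fin n → Fin q)
    (A : Algorithm q n s w) (hA : Correct (Γ.pattern n) S₀ A) (hn : 0 < n)
    (hN : n ≤ 2 ^ (b + 1) * N) :
    (Nat.log 2 n - (b + 3)) * (Fintype.card (Fin N → Γ.Index) * (r * n)) ≤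
      2 ^ 6 * 2 ^ b * ((κ + 2) * w) *
        ∑ φ : Fin N → Γ.Index,
          A.totalProbes (fun p => ⟨Γ.stream φ p, Γ.stream_lt hq φ p⟩) := by
  classical
  set τ : (Fin N → Γ.Index) → ℕ → ℕ → ℕ := fun φ e v =>
    (A.transfer (fun p => ⟨Γ.stream φ p, Γ.stream_lt hq φ p⟩) (b + 3 + e) v).card with hτ
  have hscale : ∀ e ∈ Finset.range (Nat.log 2 n - (b + 3)),
      Fintype.card (Fin N → Γ.Index) * (r * n) ≤ 2 ^ 6 * 2 ^ b * ((κ + 2) * w) *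
        ∑ v ∈ Finset.range (n / 2 ^ (b + 3 + e + 1)), ∑ φ, τ φ e v := by
    intro e he
    rw [Finset.mem_range] at he
    have hle : 2 ^ (b + 3 + e + 1) ≤ n :=
      (Nat.pow_le_pow_right (by norm_num) (by omega)).trans (Nat.pow_log_le_self 2 hn.ne')
    -- Discarding the incomplete last pair of periods costs at most a factor 2.
    have hcount : n ≤ 2 * 2 ^ (b + 3 + e + 1) * (n / 2 ^ (b + 3 + e + 1)) := by
      have h1 := Nat.lt_mul_div_succ n (show 0 < 2 ^ (b + 3 + e + 1) by positivity)
      have h2 := Nat.div_pos hle (show 0 < 2 ^ (b + 3 + e + 1) by positivity)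
      nlinarith
    have hnode : (n / 2 ^ (b + 3 + e + 1)) * (Fintype.card (Fin N → Γ.Index) * (r * 2 ^ e)) ≤
        2 * ((κ + 2) * w) *
          ∑ v ∈ Finset.range (n / 2 ^ (b + 3 + e + 1)), ∑ φ, τ φ e v := by
      rw [Finset.mul_sum]
      nth_rewrite 1 [← Finset.card_range (n / 2 ^ (b + 3 + e + 1))]
      rw [← smul_eq_mul]
      refine Finset.card_nsmul_le_sum _ _ _ fun v hv => ?_
      refine Γ.card_mul_le_sum_transfer hq hw hs hr hΓ S₀ A hA e v ?_ hN
      rw [Finset.mem_range] at hv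
      exact (Nat.mul_le_mul_left _ hv).trans (Nat.mul_div_le _ _)
    have e1 : 2 ^ (b + 3 + e + 1) = 2 ^ 4 * 2 ^ b * 2 ^ e := by
      rw [← pow_add, ← pow_add]; congr 1; omega
    calc Fintype.card (Fin N → Γ.Index) * (r * n)
        ≤ Fintype.card (Fin N → Γ.Index) *
          (r * (2 * 2 ^ (b + 3 + e + 1) * (n / 2 ^ (b + 3 + e + 1)))) :=
          Nat.mul_le_mul_left _ (Nat.mul_le_mul_left _ hcount)
      _ = 2 * (2 ^ 4 * 2 ^ b) * ((n / 2 ^ (b + 3 + e + 1)) *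
          (Fintype.card (Fin N → Γ.Index) * (r * 2 ^ e))) := by
          generalize n / 2 ^ (b + 3 + e + 1) = z
          rw [e1]; ring
      _ ≤ 2 * (2 ^ 4 * 2 ^ b) * (2 * ((κ + 2) * w) *
          ∑ v ∈ Finset.range (n / 2 ^ (b + 3 + e + 1)), ∑ φ, τ φ e v) :=
          Nat.mul_le_mul_left _ hnode
      _ = _ := by ring
  have hall : ∑ e ∈ Finset.range (Nat.log 2 n - (b + 3)),
      ∑ v ∈ Finset.range (n / 2 ^ (b + 3 + e + 1)), ∑ φ, τ φ e v ≤
      ∑ φ : Fin N → Γ.Index,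
        A.totalProbes (fun p => ⟨Γ.stream φ p, Γ.stream_lt hq φ p⟩) := by
    rw [Finset.sum_sigma', Finset.sum_comm]
    refine Finset.sum_le_sum fun φ _ => ?_
    refine le_trans (le_of_eq ?_) (A.sum_card_transfer_le _
      (((Finset.range (Nat.log 2 n - (b + 3))).sigma
        fun e => Finset.range (n / 2 ^ (b + 3 + e + 1))).image fun x => (b + 3 + x.1, x.2)))
    rw [Finset.sum_image]
    rintro ⟨e, v⟩ _ ⟨e', v'⟩ _ h
    simp only [Prod.mk.injEq, Nat.add_left_cancel_iff] at h
    obtain ⟨rfl, rfl⟩ := h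
    rfl
  calc (Nat.log 2 n - (b + 3)) * (Fintype.card (Fin N → Γ.Index) * (r * n))
      ≤ ∑ e ∈ Finset.range (Nat.log 2 n - (b + 3)), 2 ^ 6 * 2 ^ b * ((κ + 2) * w) *
        ∑ v ∈ Finset.range (n / 2 ^ (b + 3 + e + 1)), ∑ φ, τ φ e v := by
        nth_rewrite 1 [← Finset.card_range (Nat.log 2 n - (b + 3))]
        rw [← smul_eq_mul]
        exact Finset.card_nsmul_le_sum _ _ _ hscale
    _ = 2 ^ 6 * 2 ^ b * ((κ + 2) * w) * ∑ e ∈ Finset.range (Nat.log 2 n - (b + 3)),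
        ∑ v ∈ Finset.range (n / 2 ^ (b + 3 + e + 1)), ∑ φ, τ φ e v := by rw [Finset.mul_sum]
    _ ≤ _ := Nat.mul_le_mul_left _ hall

end Gadget

/-- A stream with an arbitrary first bit. -/
def bitStream {q n : ℕ} (hq : 2 ≤ q) (x : Bool) (p : Fin n) : Fin q :=
  ⟨if p.val = 0 then x.toNat else 0, by
    have := Bool.toNat_lt x
    split_ifs <;> omega⟩

/-- A correct algorithm has to remember the first symbol when the second one arrives. -/
theorem one_le_sum_totalProbes {q n s w : ℕ} (hq : 2 ≤ q) (hn : 2 ≤ n) (F S₀ : Fin n → Fin q)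
    (hF : ∀ i, (F i : ℕ) = if n - 1 - i = 1 then 1 else 0) (A : Algorithm q n s w)
    (hA : Correct F S₀ A) : 1 ≤ ∑ x, A.totalProbes (bitStream hq x) := by
  -- The periods are the arrivals 0 and 1. Without probes both streams would have empty transfer,
  -- but at most one may.
  have h := A.card_transfer_le (Φ := Bool) (Y := Unit) (bitStream hq) (fun _ => ()) 0 0 0 ?_ ?_
  · rw [Fintype.card_unit, pow_zero, one_mul] at h
    by_contra hc
    have h0 : ∀ x : Bool, (A.transfer (bitStream hq x) 0 0).card ≤ 0 := by
      intro x
      have h1 := A.sum_card_transfer_le (bitStream hq x) {(0, 0)}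
      rw [Finset.sum_singleton] at h1
      have h2 := Finset.single_le_sum (f := fun x => A.totalProbes (bitStream hq x))
        (fun _ _ => Nat.zero_le _) (Finset.mem_univ x)
      dsimp only at h1 h2
      omega
    simp only [h0, Finset.filter_true, Finset.card_univ, Fintype.card_bool] at h
    omega
  · intro x y _ t ht
    have ht0 : t.val ≠ 0 := fun h => ht (by simp [h])
    simp [bitStream, ht0]
  · intro x y _ hout
    have h1 := hout ⟨1, by omega⟩ (by simp) (by simp)
    rw [hA, hA] at h1
    have h2 : ∑ p ∈ Finset.range 2,
        ((if (if p = 0 then x.toNat else 0) = (if 1 - p = 1 then 1 else 0) then (1 : ℤ) else 0) -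
          (if (if p = 0 then y.toNat else 0) = (if 1 - p = 1 then 1 else 0) then (1 : ℤ) else 0)) =
        0 := sum_matches_sub_eq_zero (fun d => if d = 1 then 1 else 0) F S₀ _ _ hF
      (fun p => if p = 0 then x.toNat else 0) (fun p => if p = 0 then y.toNat else 0)
      (fun p => rfl) (fun p => rfl) _ h1
    clear h1 hout
    revert h2
    cases x <;> cases y <;> decide

/-- For bounded `n` one probe in total is enough: `80 * 80 * 2 ^ 80 * 2 ≤ 2 ^ 100`. -/
theorem exists_stream_of_small {κ q n s w : ℕ} (hw : 0 < w) (hq : 2 ≤ q) (hn : 2 ≤ n)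
    (hn' : n < 2 ^ 80) :
    ∃ F : Fin n → Fin q, ∀ (S₀ : Fin n → Fin q) (P : RandomisedAlgorithm q n s w),
      Solves F S₀ P → ∃ U : Fin n → Fin q,
        ENNReal.ofReal (1 / (2 ^ 100 * (κ + 2)) *
          ((delta q n : ℝ) / (w : ℝ) * Real.logb 2 (n : ℝ)) * n) ≤ P.expectedProbes U := by
  refine ⟨fun i => ⟨if n - 1 - i = 1 then 1 else 0, by split_ifs <;> omega⟩, fun S₀ P hP => ?_⟩
  suffices h : ∀ A ∈ P.support, 1 / (2 ^ 100 * (κ + 2)) *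
      ((delta q n : ℝ) / (w : ℝ) * Real.logb 2 (n : ℝ)) * n * Fintype.card Bool ≤
        ((∑ x, A.totalProbes (bitStream hq x) : ℕ) : ℝ) by
    obtain ⟨x, hx⟩ := P.exists_le_expectedProbes (bitStream hq) h
    exact ⟨_, hx⟩
  · intro A hA
    have h1 := one_le_sum_totalProbes hq hn _ S₀ (fun i => rfl) A (hP A hA)
    have h1' : (1 : ℝ) ≤ ((∑ x, A.totalProbes (bitStream hq x) : ℕ) : ℝ) := by exact_mod_cast h1
    refine le_trans ?_ h1'
    have hn0 : (0 : ℝ) < n := by exact_mod_cast (by omega : 0 < n)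
    have hδ : (delta q n : ℝ) ≤ 80 := by
      exact_mod_cast delta_le_of_right_le (by omega) hn'.le
    have hlog0 : 0 ≤ Real.logb 2 (n : ℝ) :=
      Real.logb_nonneg (by norm_num) (by exact_mod_cast (by omega : 1 ≤ n))
    have hnle : (n : ℝ) ≤ 2 ^ 80 := by exact_mod_cast hn'.le
    have hlog : Real.logb 2 (n : ℝ) ≤ 80 := by
      rw [Real.logb_le_iff_le_rpow (by norm_num) hn0]
      exact_mod_cast hn'.le
    have hw1 : (1 : ℝ) ≤ w := by exact_mod_cast hw
    have hδw : (delta q n : ℝ) / w ≤ 80 := (div_le_self (Nat.cast_nonneg _) hw1).trans hδ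
    have hc : 1 / (2 ^ 100 * ((κ : ℝ) + 2)) ≤ 1 / 2 ^ 100 := by
      refine one_div_le_one_div_of_le (by positivity) ?_
      nlinarith [Nat.cast_nonneg (α := ℝ) κ]
    calc 1 / (2 ^ 100 * ((κ : ℝ) + 2)) * ((delta q n : ℝ) / (w : ℝ) * Real.logb 2 (n : ℝ)) * n *
          (Fintype.card Bool : ℝ)
        ≤ 1 / 2 ^ 100 * (80 * 80) * 2 ^ 80 * (Fintype.card Bool : ℝ) := by gcongr
      _ ≤ 1 := by rw [Fintype.card_bool]; norm_num

theorem exists_stream_of_large {κ q n s w : ℕ} (hw : 0 < w) (hq : 2 ≤ q) (hn : 2 ^ 80 ≤ n)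
    (hs : s ≤ 2 ^ (κ * w)) :
    ∃ F : Fin n → Fin q, ∀ (S₀ : Fin n → Fin q) (P : RandomisedAlgorithm q n s w),
      Solves F S₀ P → ∃ U : Fin n → Fin q,
        ENNReal.ofReal (1 / (2 ^ 100 * (κ + 2)) *
          ((delta q n : ℝ) / (w : ℝ) * Real.logb 2 (n : ℝ)) * n) ≤ P.expectedProbes U := by
  obtain ⟨b, r, Γ, hr, hΓ, hb, hδ⟩ := exists_gadget_delta hq hn
  have hn0 : 0 < n := by omega
  have hq0 : 0 < q := by omega
  have hlog : 80 ≤ Nat.log 2 n := Nat.le_log_of_pow_le (by norm_num) hn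
  have hX : Nonempty Γ.Index := Fintype.card_pos_iff.1 (lt_of_lt_of_le (by positivity) hΓ)
  refine ⟨Γ.pattern n, fun S₀ P hP => ?_⟩
  have hN : n ≤ 2 ^ (b + 1) * n := Nat.le_mul_of_pos_left _ (by positivity)
  suffices h : ∀ A ∈ P.support, 1 / (2 ^ 100 * (κ + 2)) *
      ((delta q n : ℝ) / (w : ℝ) * Real.logb 2 (n : ℝ)) * n * Fintype.card (Fin n → Γ.Index) ≤
        ((∑ φ : Fin n → Γ.Index,
          A.totalProbes (fun p => ⟨Γ.stream φ p, Γ.stream_lt hq0 φ p⟩) : ℕ) : ℝ) by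
    obtain ⟨φ, hφ⟩ := P.exists_le_expectedProbes (Φ := Fin n → Γ.Index)
      (fun φ p => ⟨Γ.stream φ p, Γ.stream_lt hq0 φ p⟩) h
    exact ⟨_, hφ⟩
  · intro A hA
    have h1 := Γ.card_mul_le_sum_totalProbes hq0 hw hs hr hΓ S₀ A (hP A hA) hn0 hN
    set T := ∑ φ : Fin n → Γ.Index,
      A.totalProbes (fun p => ⟨Γ.stream φ p, Γ.stream_lt hq0 φ p⟩) with hT
    set D := Fintype.card (Fin n → Γ.Index) with hD
    -- Since `4 * b ≤ log n`, the scales longer than the gadget are a constant proportion of all.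
    have h2 : Real.logb 2 (n : ℝ) ≤ 4 * ((Nat.log 2 n - (b + 3) : ℕ) : ℝ) := by
      have h3 : Real.logb 2 (n : ℝ) ≤ ((Nat.log 2 n + 1 : ℕ) : ℝ) := by
        rw [Real.logb_le_iff_le_rpow (by norm_num) (by exact_mod_cast hn0), Real.rpow_natCast]
        exact_mod_cast (Nat.lt_pow_succ_log_self (by norm_num) n).le
      refine h3.trans ?_
      exact_mod_cast (by omega : Nat.log 2 n + 1 ≤ 4 * (Nat.log 2 n - (b + 3)))
    generalize Nat.log 2 n - (b + 3) = E at h1 h2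
    have hδ' : (delta q n : ℝ) * 2 ^ b ≤ 800 * r := by exact_mod_cast hδ
    have h1' : (E : ℝ) * (D * (r * n)) ≤ 2 ^ 6 * 2 ^ b * ((κ + 2) * w) * T := by
      exact_mod_cast h1
    have hw' : (0 : ℝ) < w := by exact_mod_cast hw
    have hB : (0 : ℝ) < 2 ^ b := by positivity
    have hκ : (0 : ℝ) < (κ : ℝ) + 2 := by positivity
    have hn' : (0 : ℝ) ≤ n := Nat.cast_nonneg _
    have hD' : (0 : ℝ) ≤ D := Nat.cast_nonneg _
    have hlog0 : 0 ≤ Real.logb 2 (n : ℝ) :=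
      Real.logb_nonneg (by norm_num) (by exact_mod_cast hn0)
    refine le_of_mul_le_mul_right (a := 2 ^ 100 * (((κ : ℝ) + 2) * w) * 2 ^ b) ?_ (by positivity)
    calc 1 / (2 ^ 100 * ((κ : ℝ) + 2)) * ((delta q n : ℝ) / w * Real.logb 2 n) * n * D *
          (2 ^ 100 * ((κ + 2) * w) * 2 ^ b)
        = (delta q n * 2 ^ b) * Real.logb 2 n * n * D := by field_simp
      _ ≤ (800 * r) * (4 * E) * n * D := by gcongr
      _ = 3200 * (E * (D * (r * n))) := by ring
      _ ≤ 3200 * (2 ^ 6 * 2 ^ b * ((κ + 2) * w) * T) := by gcongr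
      _ = T * (3200 * 2 ^ 6 * ((κ + 2) * w) * 2 ^ b) := by ring
      _ ≤ T * (2 ^ 100 * ((κ + 2) * w) * 2 ^ b) := by gcongr; norm_num

end OnlineHamming

theorem theorem3 (κ : ℕ) :
    ∃ c : ℝ, 0 < c ∧
      ∀ q n w s : ℕ, 0 < q → 0 < n → 0 < w →
        Real.logb 2 (n : ℝ) ≤ (κ : ℝ) * (w : ℝ) → s ≤ 2 ^ (κ * w) →
        ∃ F : Fin n → Fin q, ∀ (S₀ : Fin n → Fin q) (P : CellProbe.RandomisedAlgorithm q n s w),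
          OnlineHamming.Solves F S₀ P →
          ∃ U : Fin n → Fin q,
            ENNReal.ofReal
                (c * ((OnlineHamming.delta q n : ℝ) / (w : ℝ) * Real.logb 2 (n : ℝ))) ≤
              P.expectedProbes U / (n : ENNReal) := by
  refine ⟨1 / (2 ^ 100 * (κ + 2)), by positivity, fun q n w s hq hn hw _ hs => ?_⟩
  have key : ∃ F : Fin n → Fin q, ∀ (S₀ : Fin n → Fin q)
      (P : CellProbe.RandomisedAlgorithm q n s w), OnlineHamming.Solves F S₀ P →
        ∃ U : Fin n → Fin q,
          ENNReal.ofReal (1 / (2 ^ 100 * (κ + 2)) *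
            ((OnlineHamming.delta q n : ℝ) / (w : ℝ) * Real.logb 2 (n : ℝ)) * n) ≤
              P.expectedProbes U := by
    -- The bound is zero in the degenerate cases: `δ = 0` for `q = 1` and `log n = 0` for `n = 1`.
    by_cases hq2 : 2 ≤ q
    · by_cases hn2 : 2 ≤ n
      · by_cases hn80 : n < 2 ^ 80
        · exact OnlineHamming.exists_stream_of_small hw hq2 hn2 hn80
        · exact OnlineHamming.exists_stream_of_large hw hq2 (not_lt.1 hn80) hs
      · have hn1 : n = 1 := by omega
        subst hn1
        exact ⟨fun _ => ⟨0, hq⟩, fun S₀ P _ => ⟨fun _ => ⟨0, hq⟩, by simp⟩⟩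
    · have hδ : OnlineHamming.delta q n = 0 :=
        Nat.le_zero.1 (OnlineHamming.delta_le_of_left_le hq (by rw [pow_zero]; omega))
      exact ⟨fun _ => ⟨0, hq⟩, fun S₀ P _ => ⟨fun _ => ⟨0, hq⟩, by simp [hδ]⟩⟩
  obtain ⟨F, hF⟩ := key
  refine ⟨F, fun S₀ P hP => ?_⟩
  obtain ⟨U, hU⟩ := hF S₀ P hP
  refine ⟨U, ?_⟩
  rw [ENNReal.le_div_iff_mul_le (Or.inl (by exact_mod_cast hn.ne'))
    (Or.inl (ENNReal.natCast_ne_top n))]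
  rwa [ENNReal.ofReal_mul' (Nat.cast_nonneg n), ENNReal.ofReal_natCast] at hU
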